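/- Let $k,\phi>0$, $\xi_0,\eta_0\in\mathbb R$, $c_0=k\coth\phi$, and let $c>0$ satisfy either $c>c_0+k$ (bright breather) or $c<c_0-k$ (dark breather). Put $$\beta=\frac{2ck}{(c-c_0)^2-k^2},\qquad \xi=x-c_0t-\xi_0,\qquad \eta=x-ct-\eta_0 ,$$ $$\hat u(x,t)=\frac{2(c+k\beta)\cosh\phi+[k(1+\beta^2+c^2\eta^2)+2\beta c]\sinh\phi+2c\cos(k\xi)}{(1+\beta^2+c^2\eta^2)\cosh\phi+2\beta\sinh\phi+(1-\beta^2+c^2\eta^2)\cos(k\xi)+2\beta c\eta\sin(k\xi)},$$ $$f=\beta(1-e^{ik\xi+\phi})-(1+ic\eta)(1+e^{ik\xi+\phi}),\qquad f'=\beta(1-e^{ik\xi-\phi})+(1-ic\eta)(1+e^{ik\xi-\phi})$$ ($f'$ is not a derivative of $f$). Then: 1. The denominator of $\hat u$ is positive for all real $\xi,\eta$, and the real-valued function $\hat u$ is a classical ($C^2$) solution on $\mathbb R\times\mathbb R$ of the Benjamin--Ono equation $$u_t+2uu_x+H(u_{xx})=0,\qquad H(g)(x)=\frac1\pi\,\mathrm{p.v.}\!\int_{-\infty}^{\infty}\frac{g(y)\,dy}{y-x},$$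 where the integral is a principal value at $y=x$ and a convergent improper integral at $-\infty$ and at $+\infty$. 2. $\hat u$ is bounded on $\mathbb R\times\mathbb R$. 3. $\hat u=i\,\partial_x\log(f'/f)$ on $\mathbb R\times\mathbb R$ (logarithmic derivative). 4. For every real $t$, as functions of complex $x$, all zeros of $f$ lie in the open upper half-plane and all zeros of $f'$ lie in the open lower half-plane. Moreover, regarding $f$ as a function of independent variables $\xi\in\mathbb C$ and $\eta\in\mathbb R$, every zero satisfies $$\operatorname{Im}\xi=k^{-1}(\phi+q),\qquad q=\frac12\log\frac{(\beta+1)^2+c^2\eta^2}{(\beta-1)^2+c^2\eta^2}>0 .$$ 5. As $\eta\to\pm\infty$, uniformly in $(x,t)$, $\hat u(x,t)$ tends to the periodic wave $\dfrac{k\sinh\phi}{\cos(k\xi)+\cosh\phi}$ with the same $\xi=x-c_0t-\xi_0$ at both ends (no phase shift): for every $\varepsilon>0$ there is $R$ such that the two functions differ by less than $\varepsilon$ at all $(x,t)$ with $|\eta|\ge R$. -/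

import Mathlib

open Filter Topology

noncomputable section

/-- `h` is the value at `x` of `H(f) = (1/π) p.v. ∫_{-∞}^{∞} f(y) / (y - x) dy`: the integral is
cut symmetrically around the singularity `y = x` (at distance `p.1 → 0+`), and is an improper
integral at `-∞` and at `+∞` (the two cut-offs `p.2.1, p.2.2 → +∞` are independent). -/
def HasHilbertTransformAt (f : ℝ → ℝ) (x h : ℝ) : Prop :=
  Tendsto
    (fun p : ℝ × ℝ × ℝ =>
      (1 / Real.pi) *
        ((∫ y in (x - p.2.1)..(x - p.1), f y / (y - x)) +
          ∫ y in (x + p.1)..(x + p.2.2), f y / (y - x)))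
    (𝓝[>] (0 : ℝ) ×ˢ (atTop ×ˢ atTop)) (𝓝 h)

/-- `u` is a classical solution on `ℝ × ℝ` of `u_t + 2 u u_x + H(u_xx) = 0`; the existence of
the principal value `H(u_xx)` at every point is part of the definition. -/
def IsClassicalBOSolution (u : ℝ → ℝ → ℝ) : Prop :=
  ContDiff ℝ 2 (fun p : ℝ × ℝ => u p.1 p.2) ∧
    ∀ x t : ℝ, ∃ h : ℝ,
      HasHilbertTransformAt (fun y => iteratedDeriv 2 (fun s => u s t) y) x h ∧
        deriv (fun τ => u x τ) t + 2 * u x t * deriv (fun s => u s t) x + h = 0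

/-- The speed `c₀ = k coth φ` of the periodic traveling wave. -/
def waveSpeed (k φ : ℝ) : ℝ := k * (Real.cosh φ / Real.sinh φ)

/-- The periodic traveling wave, with `ξ = x - c₀ t - ξ₀`. -/
def periodicWave (k φ ξ₀ x t : ℝ) : ℝ :=
  k * Real.sinh φ / (Real.cos (k * (x - waveSpeed k φ * t - ξ₀)) + Real.cosh φ)

/-- `β = 2 c k / ((c - c₀)² - k²)`. -/
def breatherBeta (k φ c : ℝ) : ℝ := 2 * c * k / ((c - waveSpeed k φ) ^ 2 - k ^ 2)

/-- Numerator of the breather as a function of `ξ` and `η`. -/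
def breatherNum (k φ c ξ η : ℝ) : ℝ :=
  2 * (c + k * breatherBeta k φ c) * Real.cosh φ +
    (k * (1 + breatherBeta k φ c ^ 2 + c ^ 2 * η ^ 2) + 2 * breatherBeta k φ c * c) *
      Real.sinh φ +
    2 * c * Real.cos (k * ξ)

/-- Denominator of the breather as a function of `ξ` and `η`. -/
def breatherDen (k φ c ξ η : ℝ) : ℝ :=
  (1 + breatherBeta k φ c ^ 2 + c ^ 2 * η ^ 2) * Real.cosh φ +
    2 * breatherBeta k φ c * Real.sinh φ +
    (1 - breatherBeta k φ c ^ 2 + c ^ 2 * η ^ 2) * Real.cos (k * ξ) +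
    2 * breatherBeta k φ c * c * η * Real.sin (k * ξ)

/-- The breather `û(x,t)`, with `ξ = x - c₀ t - ξ₀` and `η = x - c t - η₀`. -/
def breather (k φ c ξ₀ η₀ x t : ℝ) : ℝ :=
  breatherNum k φ c (x - waveSpeed k φ * t - ξ₀) (x - c * t - η₀) /
    breatherDen k φ c (x - waveSpeed k φ * t - ξ₀) (x - c * t - η₀)

/-- `f = β (1 - e^{ikξ+φ}) - (1 + icη) (1 + e^{ikξ+φ})`, for complex `ξ` and `η`. -/
def breatherF (k φ c : ℝ) (ξ η : ℂ) : ℂ :=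
  (breatherBeta k φ c : ℂ) * (1 - Complex.exp (Complex.I * k * ξ + φ)) -
    (1 + Complex.I * c * η) * (1 + Complex.exp (Complex.I * k * ξ + φ))

/-- `f' = β (1 - e^{ikξ-φ}) + (1 - icη) (1 + e^{ikξ-φ})`, for complex `ξ` and `η`
(the prime is part of the name, it is not a derivative). -/
def breatherF' (k φ c : ℝ) (ξ η : ℂ) : ℂ :=
  (breatherBeta k φ c : ℂ) * (1 - Complex.exp (Complex.I * k * ξ - φ)) +
    (1 - Complex.I * c * η) * (1 + Complex.exp (Complex.I * k * ξ - φ))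

/-- `f` as a function of `(z, t)`, the space variable `z` being complex. -/
def breatherFxt (k φ c ξ₀ η₀ : ℝ) (z : ℂ) (t : ℝ) : ℂ :=
  breatherF k φ c (z - waveSpeed k φ * t - ξ₀) (z - c * t - η₀)

/-- `f'` as a function of `(z, t)`, the space variable `z` being complex. -/
def breatherFxt' (k φ c ξ₀ η₀ : ℝ) (z : ℂ) (t : ℝ) : ℂ :=
  breatherF' k φ c (z - waveSpeed k φ * t - ξ₀) (z - c * t - η₀)

/-- `q = (1/2) log (((β + 1)² + c² η²) / ((β - 1)² + c² η²))`. -/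
def breatherQ (k φ c η : ℝ) : ℝ :=
  1 / 2 * Real.log (((breatherBeta k φ c + 1) ^ 2 + c ^ 2 * η ^ 2) /
    ((breatherBeta k φ c - 1) ^ 2 + c ^ 2 * η ^ 2))

end

/-! Write G = ∂ₓ log f. On the real line f' is -e^{ikξ-φ} times the conjugate of f, so i ∂ₓ
log(f'/f) = -k + 2 Im G. The explicit quotient equals the same expression, because its denominator
is |f|²/(2e^φ).

Everything rests on f = (β-1-icη) - (β+1+icη) e^{ikξ+φ}. The region for c makes β > 0, hence
|β-1-icη| ≤ |β+1+icη| as long as c Im η ≤ 1, while |e^{ikξ+φ}| > 1 as long as k Im ξ < φ. So f has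
no zeros in a half-plane Im z < δ with δ > 0, and there G is holomorphic and bounded. This gives
positivity, boundedness and the location of the zeros; comparing moduli in f = 0 at real η gives Im
ξ exactly.

For the Hilbert transform, G'' need not decay along the real line, but Cauchy's estimate makes it
O((δ - Im z)⁻²) downwards. Shifting the contour down gives p.v. ∫ G''(y)/(y-x) dy = -πi G''(x) as an
improper integral, so H(u_xx) = -2 Re G'' (`hasHilbertTransformAt_iteratedDeriv_two_im`). The
equation becomes the x-derivative of kc₀ + 2 Im(f_t/f) + u² - 2 Re G' = 0 (`breather_riccati`).
Multiplied by |f|², this is `breather_bilinear`, an algebraic identity that follows from the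
relations defining c₀ and β.

For large |η|, the η² terms of the breather are those of the periodic wave and the remainder is
O(1/|η|). -/

/-! ### Contour shift in a lower half-plane. -/

/-- A holomorphic function bounded by `M` on the half-plane `Im z < δ` has a second derivative
of size `O((δ - Im z)⁻²)`. -/
lemma norm_iteratedDeriv_two_le_of_lowerHalfPlane {G : ℂ → ℂ} {δ M : ℝ}
    (hd : DifferentiableOn ℂ G {z | z.im < δ}) (hM : ∀ z : ℂ, z.im < δ → ‖G z‖ ≤ M)
    {z : ℂ} (hz : z.im < δ) : ‖iteratedDeriv 2 G z‖ ≤ 8 * M / (δ - z.im) ^ 2 := by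
  -- Half the distance to the boundary keeps the closed disc inside the domain; 2!/r² then yields
  -- the factor 8.
  have hr : 0 < (δ - z.im) / 2 := by linarith
  have hsub : Metric.closedBall z ((δ - z.im) / 2) ⊆ {w : ℂ | w.im < δ} := by
    intro w hw
    have h1 : |(w - z).im| ≤ (δ - z.im) / 2 :=
      (Complex.abs_im_le_norm _).trans (by simpa [dist_eq_norm] using hw)
    have h2 := (abs_le.1 h1).2
    simp only [Complex.sub_im] at h2
    show w.im < δ
    linarith
  have h := Complex.norm_iteratedDeriv_le_of_forall_mem_sphere_norm_le 2 hr
    (hd.mono ((closure_mono Metric.ball_subset_closedBall).trans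
      (Metric.isClosed_closedBall.closure_eq.subset.trans hsub))).diffContOnCl
    (fun w hw => hM w (hsub (Metric.sphere_subset_closedBall hw)))
  refine h.trans (le_of_eq ?_)
  have : δ - z.im ≠ 0 := by linarith
  simp only [Nat.factorial]
  push_cast
  field_simp
  ring

/-- The integral along a real segment of a function holomorphic in a lower half-plane is
controlled by the distances from the ends to a base point `x`, when the function is
`O((δ - Im z)⁻² |z - x|⁻¹)`. -/
lemma norm_integral_real_segment_le {K : ℂ → ℂ} {x δ C a b : ℝ} (hδ : 0 < δ) (hC : 0 ≤ C)
    (ha : 0 < a) (hb : 0 < b) (hd : DifferentiableOn ℂ K {z | z.im < δ})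
    (hK : ∀ z : ℂ, z.im ≤ 0 → z ≠ x → ‖K z‖ ≤ C / (δ - z.im) ^ 2 / ‖z - x‖) :
    ‖∫ y in (x - a)..(x + b), K (y : ℂ)‖ ≤ C / δ * (1 / a + 1 / b) := by
  -- Cauchy's theorem on the rectangle of depth Y: the first term bounds the bottom side, the second
  -- the two vertical sides uniformly in Y. Letting Y → ∞ removes the first.
  have key : ∀ Y : ℝ, 0 < Y → ‖∫ y in (x - a)..(x + b), K (y : ℂ)‖ ≤
      C / (δ + Y) ^ 2 / Y * (a + b) + C / δ * (1 / a + 1 / b) := by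
    intro Y hY
    have hrect := Complex.integral_boundary_rect_eq_zero_of_differentiableOn K
      (⟨x - a, -Y⟩ : ℂ) (⟨x + b, 0⟩ : ℂ) (hd.mono (by
        intro z hz
        have := hz.2
        rw [Set.mem_preimage, Set.uIcc_of_le (by simpa using hY.le)] at this
        exact lt_of_le_of_lt this.2 hδ))
    simp only [Complex.ofReal_zero, zero_mul, add_zero] at hrect
    have hbot : ‖∫ y in (x - a)..(x + b), K (y + ((-Y : ℝ) : ℂ) * Complex.I)‖ ≤
        C / (δ + Y) ^ 2 / Y * (a + b) := by
      refine (intervalIntegral.norm_integral_le_of_norm_le_const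
        (C := C / (δ + Y) ^ 2 / Y) ?_).trans (le_of_eq ?_)
      · intro y _
        have hn : Y ≤ ‖(y : ℂ) + ((-Y : ℝ) : ℂ) * Complex.I - x‖ := by
          refine le_trans ?_ (Complex.abs_im_le_norm _)
          simp [abs_of_pos hY]
        refine (hK _ (by simp [hY.le]) ?_).trans ?_
        · intro h
          rw [h] at hn
          simp at hn
          linarith
        · simp only [Complex.add_im, Complex.ofReal_im, Complex.mul_im, Complex.ofReal_re,
            Complex.I_im, Complex.I_re, mul_one, mul_zero, zero_add, add_zero, sub_neg_eq_add]
          gcongr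
      · rw [show x + b - (x - a) = a + b by ring, abs_of_pos (by positivity)]
    have hside : ∀ s r : ℝ, 0 < r → r = |s - x| →
        ‖∫ y in (-Y)..0, K (s + y * Complex.I)‖ ≤ C / δ * (1 / r) := by
      intro s r hr hrs
      -- On a vertical side |z - x| ≥ r, and the remaining factor (δ - y)⁻² has an explicit
      -- primitive, so the side contributes at most C/(δ r) at any depth.
      have hder : ∀ y ∈ Set.uIcc (-Y) 0,
          HasDerivAt (fun y : ℝ => C / r * (δ - y)⁻¹) (C / (δ - y) ^ 2 / r) y := by
        intro y hy
        rw [Set.uIcc_of_le (by linarith)] at hy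
        have hne : δ - y ≠ 0 := by linarith [hy.2]
        refine ((((hasDerivAt_id' y).const_sub δ).fun_inv hne).const_mul (C / r)).congr_deriv ?_
        field_simp
      have hint : IntervalIntegrable (fun y : ℝ => C / (δ - y) ^ 2 / r) MeasureTheory.volume
          (-Y) 0 := by
        refine ContinuousOn.intervalIntegrable ?_
        rw [Set.uIcc_of_le (by linarith)]
        refine ContinuousOn.div_const (ContinuousOn.div (by fun_prop) (by fun_prop) ?_) _
        intro y hy
        have : δ - y ≠ 0 := by linarith [hy.2]
        positivity
      refine (intervalIntegral.norm_integral_le_of_norm_le (by linarith)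
        (Filter.Eventually.of_forall ?_) hint).trans ?_
      · intro y hy
        have hn : r ≤ ‖(s : ℂ) + y * Complex.I - x‖ := by
          rw [hrs]
          refine le_trans (le_of_eq ?_) (Complex.abs_re_le_norm _)
          simp
        refine (hK _ (by simpa using hy.2) ?_).trans ?_
        · intro h
          rw [h] at hn
          simp at hn
          linarith
        · simp only [Complex.add_im, Complex.ofReal_im, Complex.mul_im, Complex.ofReal_re,
            Complex.I_im, Complex.I_re, mul_one, mul_zero, zero_add, add_zero]
          gcongr
      · rw [intervalIntegral.integral_eq_sub_of_hasDerivAt hder hint]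
        have : 0 ≤ C / r * (δ - -Y)⁻¹ := by
          rw [sub_neg_eq_add]
          positivity
        have h2 : C / r * (δ - 0)⁻¹ = C / δ * (1 / r) := by
          rw [sub_zero]
          field_simp
        linarith
    have hR := hside (x + b) b hb (by simp [abs_of_pos hb])
    have hL := hside (x - a) a ha (by simp [abs_of_pos ha])
    have heq : (∫ y in (x - a)..(x + b), K (y : ℂ)) =
        (∫ y in (x - a)..(x + b), K (y + ((-Y : ℝ) : ℂ) * Complex.I)) +
          Complex.I • (∫ y in (-Y)..0, K ((x + b : ℝ) + y * Complex.I)) -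
          Complex.I • (∫ y in (-Y)..0, K ((x - a : ℝ) + y * Complex.I)) := by
      linear_combination -hrect
    rw [heq]
    refine (norm_sub_le _ _).trans ((add_le_add (norm_add_le _ _) le_rfl).trans ?_)
    rw [norm_smul, norm_smul, Complex.norm_I, one_mul, one_mul]
    linarith
  have hlim : Tendsto (fun Y : ℝ => C / (δ + Y) ^ 2 / Y * (a + b) + C / δ * (1 / a + 1 / b)) atTop
      (𝓝 (0 * (a + b) + C / δ * (1 / a + 1 / b))) := by
    refine Tendsto.add_const _ (Tendsto.mul_const _ (Tendsto.div_atTop (a := 0) ?_ tendsto_id))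
    refine Tendsto.div_atTop tendsto_const_nhds ?_
    exact (tendsto_pow_atTop two_ne_zero).comp (tendsto_atTop_add_const_left _ _ tendsto_id)
  have := ge_of_tendsto hlim (by
    filter_upwards [eventually_gt_atTop 0] with Y hY using key Y hY)
  simpa using this

/-! ### An explicit kernel with the same pole. -/

/-- A primitive of `1 / (s (1 + i s)²)` away from `s = 0`. -/
noncomputable def poleComparisonPrimitive (s : ℝ) : ℂ :=
  ((Real.log s - 1 / 2 * Real.log (1 + s ^ 2) : ℝ) : ℂ) - Complex.I * (Real.arctan s : ℝ) +
    1 / (1 + Complex.I * s)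

lemma one_add_I_mul_ofReal_ne_zero (s : ℝ) : (1 : ℂ) + Complex.I * s ≠ 0 := by
  intro h
  have := congrArg Complex.re h
  simp at this

lemma hasDerivAt_poleComparisonPrimitive {s : ℝ} (hs : s ≠ 0) :
    HasDerivAt poleComparisonPrimitive (1 / (s * (1 + Complex.I * s) ^ 2)) s := by
  have h1 : HasDerivAt (fun s : ℝ => Real.log s - 1 / 2 * Real.log (1 + s ^ 2))
      (s⁻¹ - 1 / 2 * ((2 * s) / (1 + s ^ 2))) s := by
    refine (Real.hasDerivAt_log hs).sub (HasDerivAt.const_mul _ (HasDerivAt.log ?_ (by positivity)))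
    simpa using ((hasDerivAt_id s).pow 2).const_add 1
  have h2 := (Real.hasDerivAt_arctan s).ofReal_comp.const_mul Complex.I
  have h3 : HasDerivAt (fun s : ℝ => (1 : ℂ) / (1 + Complex.I * s))
      (-(Complex.I) / (1 + Complex.I * s) ^ 2) s := by
    have h4 : HasDerivAt (fun s : ℝ => (1 : ℂ) + Complex.I * s) Complex.I s := by
      simpa using ((hasDerivAt_id s).ofReal_comp.const_mul Complex.I).const_add 1
    simpa only [one_div] using! h4.inv (one_add_I_mul_ofReal_ne_zero s)
  have h := (h1.ofReal_comp.sub h2).add h3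
  refine h.congr_deriv ?_
  have e1 := one_add_I_mul_ofReal_ne_zero s
  have e2 : (s : ℂ) ≠ 0 := by exact_mod_cast hs
  have e3 : (1 : ℂ) + s ^ 2 ≠ 0 := by
    have : (1 : ℝ) + s ^ 2 ≠ 0 := by positivity
    exact_mod_cast this
  have e4 : (1 : ℂ) + s ^ 2 = (1 + Complex.I * s) * (1 - Complex.I * s) := by
    linear_combination (s : ℂ) ^ 2 * Complex.I_sq
  have e5 : (1 : ℂ) - Complex.I * s ≠ 0 := fun h => e3 (by rw [e4, h, mul_zero])
  push_cast
  rw [e4]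
  rw [mul_comm] at e1 e5
  field_simp
  ring_nf
  simp only [Complex.I_sq, Complex.I_pow_three]
  ring

lemma log_sub_half_log_one_add_sq {s : ℝ} (hs : s ≠ 0) :
    Real.log s - 1 / 2 * Real.log (1 + s ^ 2) = -(1 / 2) * Real.log (1 + (s⁻¹) ^ 2) := by
  have h : 1 + s ^ 2 = s ^ 2 * (1 + (s⁻¹) ^ 2) := by
    field_simp
    ring
  rw [h, Real.log_mul (by positivity) (by positivity), Real.log_pow]
  push_cast
  ring

/-- In the variable 1/s every term except the arctangent is continuous at 0 and vanishes there, so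
one argument serves both infinities. -/
lemma poleComparisonPrimitive_eq {s : ℝ} (hs : s ≠ 0) :
    poleComparisonPrimitive s = ((-(1 / 2) * Real.log (1 + (s⁻¹) ^ 2) : ℝ) : ℂ) -
      Complex.I * (Real.arctan s : ℝ) + (s⁻¹ : ℝ) / ((s⁻¹ : ℝ) + Complex.I) := by
  have e1 := one_add_I_mul_ofReal_ne_zero s
  have e2 : (s : ℂ) ≠ 0 := by exact_mod_cast hs
  rw [poleComparisonPrimitive, log_sub_half_log_one_add_sq hs]
  congr 1
  push_cast
  have e3 : (s : ℂ)⁻¹ + Complex.I ≠ 0 := by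
    intro h
    apply e1
    have := congrArg (fun w => (s : ℂ) * w) h
    simp only [mul_add, mul_inv_cancel₀ e2, mul_zero] at this
    linear_combination this
  rw [div_eq_div_iff e1 e3]
  field_simp

lemma tendsto_poleComparisonPrimitive_aux {l : Filter ℝ} {a : ℝ}
    (hl : Tendsto (fun s : ℝ => s⁻¹) l (𝓝 0)) (hne : ∀ᶠ s in l, s ≠ 0)
    (ha : Tendsto Real.arctan l (𝓝 a)) :
    Tendsto poleComparisonPrimitive l (𝓝 (-(Complex.I * a))) := by
  have h1 : Tendsto (fun s : ℝ => ((-(1 / 2) * Real.log (1 + (s⁻¹) ^ 2) : ℝ) : ℂ)) l (𝓝 0) := by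
    have hc : ContinuousAt (fun v : ℝ => ((-(1 / 2) * Real.log (1 + v ^ 2) : ℝ) : ℂ)) 0 := by
      refine Complex.continuous_ofReal.continuousAt.comp ?_
      exact continuousAt_const.mul (ContinuousAt.log (by fun_prop) (by norm_num))
    have := hc.tendsto.comp hl
    simpa [Function.comp_def] using this
  have h2 : Tendsto (fun s : ℝ => Complex.I * ((Real.arctan s : ℝ) : ℂ)) l (𝓝 (Complex.I * a)) :=
    ((Complex.continuous_ofReal.tendsto a).comp ha).const_mul _
  have h3 : Tendsto (fun s : ℝ => ((s⁻¹ : ℝ) : ℂ) / ((s⁻¹ : ℝ) + Complex.I)) l (𝓝 0) := by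
    have hc : ContinuousAt (fun v : ℝ => (v : ℂ) / (v + Complex.I)) 0 :=
      ContinuousAt.div (by fun_prop) (by fun_prop) (by simp)
    simpa [Function.comp_def] using hc.tendsto.comp hl
  have := (h1.sub h2).add h3
  simp only [zero_sub, add_zero] at this
  refine this.congr' ?_
  filter_upwards [hne] with s hs using (poleComparisonPrimitive_eq hs).symm

lemma tendsto_poleComparisonPrimitive_atTop :
    Tendsto poleComparisonPrimitive atTop (𝓝 (-(Complex.I * (Real.pi / 2 : ℝ)))) :=
  tendsto_poleComparisonPrimitive_aux tendsto_inv_atTop_zero (eventually_ne_atTop 0)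
    (tendsto_nhds_of_tendsto_nhdsWithin Real.tendsto_arctan_atTop)

lemma tendsto_poleComparisonPrimitive_atBot :
    Tendsto poleComparisonPrimitive atBot (𝓝 (Complex.I * (Real.pi / 2 : ℝ))) := by
  have := tendsto_poleComparisonPrimitive_aux tendsto_inv_atBot_zero (eventually_ne_atBot 0)
    (tendsto_nhds_of_tendsto_nhdsWithin Real.tendsto_arctan_atBot)
  simpa using this

/-- `Real.log` is even, so the logarithmic singularity cancels between -s and s. This is where the
symmetric cut around the pole is used. -/
lemma tendsto_poleComparisonPrimitive_neg_sub :
    Tendsto (fun s => poleComparisonPrimitive (-s) - poleComparisonPrimitive s) (𝓝[>] 0)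
      (𝓝 0) := by
  have hc : ContinuousAt (fun s : ℝ => 2 * Complex.I * (Real.arctan s : ℝ) +
      1 / (1 + Complex.I * ((-s : ℝ) : ℂ)) - 1 / (1 + Complex.I * s)) 0 := by
    refine ContinuousAt.sub (ContinuousAt.add ?_ ?_) ?_
    · exact continuousAt_const.mul
        (Complex.continuous_ofReal.comp Real.continuous_arctan).continuousAt
    · exact ContinuousAt.div (by fun_prop) (by fun_prop) (one_add_I_mul_ofReal_ne_zero _)
    · exact ContinuousAt.div (by fun_prop) (by fun_prop) (one_add_I_mul_ofReal_ne_zero _)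
  have h := hc.tendsto.mono_left (nhdsWithin_le_nhds (s := Set.Ioi 0))
  simp only [Real.arctan_zero, Complex.ofReal_zero, mul_zero, neg_zero, add_zero, div_one,
    zero_add, sub_self] at h
  refine h.congr fun s => ?_
  simp only [poleComparisonPrimitive, Real.log_neg_eq_log, Real.arctan_neg, neg_sq,
    Complex.ofReal_neg]
  ring

/-! ### Principal values and the Hilbert transform. -/

/-- The primitive of `h (y) / (y - x)` on a segment avoiding `x`. -/
lemma integral_div_sub_eq {h : ℂ → ℂ} {x u v : ℝ} (hx : x ∉ Set.uIcc u v)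
    (hk : Continuous fun y : ℝ =>
      dslope (fun z : ℂ => h z - h x / (1 + Complex.I * (z - x)) ^ 2) x y) :
    (∫ y in u..v, h (y : ℂ) / (y - x)) =
      (∫ y in u..v, dslope (fun z : ℂ => h z - h x / (1 + Complex.I * (z - x)) ^ 2) x (y : ℂ)) +
        h x * (poleComparisonPrimitive (v - x) - poleComparisonPrimitive (u - x)) := by
  have hne : ∀ y ∈ Set.uIcc u v, y - x ≠ 0 := fun y hy h0 => hx (by
    rwa [sub_eq_zero.1 h0] at hy)
  have hder : ∀ y ∈ Set.uIcc u v, HasDerivAt (fun y : ℝ => h x * poleComparisonPrimitive (y - x))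
      (h x * (1 / (((y - x : ℝ) : ℂ) * (1 + Complex.I * ((y - x : ℝ) : ℂ)) ^ 2))) y :=
    fun y hy => ((hasDerivAt_poleComparisonPrimitive (hne y hy)).comp_sub_const y x).const_mul _
  have hint : IntervalIntegrable (fun y : ℝ =>
      h x * (1 / (((y - x : ℝ) : ℂ) * (1 + Complex.I * ((y - x : ℝ) : ℂ)) ^ 2)))
      MeasureTheory.volume u v := by
    refine ContinuousOn.intervalIntegrable (ContinuousOn.mul continuousOn_const
      (ContinuousOn.div continuousOn_const (by fun_prop) ?_))
    intro y hy
    exact mul_ne_zero (by exact_mod_cast hne y hy) (pow_ne_zero _ (one_add_I_mul_ofReal_ne_zero _))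
  rw [mul_sub, ← intervalIntegral.integral_eq_sub_of_hasDerivAt hder hint,
    ← intervalIntegral.integral_add (hk.intervalIntegrable _ _) hint]
  refine intervalIntegral.integral_congr fun y hy => ?_
  have e1 := one_add_I_mul_ofReal_ne_zero (y - x)
  have e2 : (y : ℂ) - x ≠ 0 := by exact_mod_cast hne y hy
  have e3 : (y : ℂ) ≠ x := sub_ne_zero.1 e2
  simp only [dslope_of_ne _ e3, slope_def_field]
  push_cast at e1 ⊢
  simp only [sub_self, mul_zero, add_zero, one_pow, div_one, sub_zero]
  field_simp
  ring

/-- The principal value of `∫ G''(y) / (y - x) dy` for `G` bounded and holomorphic in a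
half-plane `Im z < δ`, `δ > 0`. -/
theorem tendsto_principalValue_iteratedDeriv_two {G : ℂ → ℂ} {δ M : ℝ} (hδ : 0 < δ)
    (hd : DifferentiableOn ℂ G {z | z.im < δ}) (hM : ∀ z : ℂ, z.im < δ → ‖G z‖ ≤ M) (x : ℝ) :
    Tendsto (fun p : ℝ × ℝ × ℝ =>
        (∫ y in (x - p.2.1)..(x - p.1), iteratedDeriv 2 G (y : ℂ) / (y - x)) +
          ∫ y in (x + p.1)..(x + p.2.2), iteratedDeriv 2 G (y : ℂ) / (y - x))
      (𝓝[>] (0 : ℝ) ×ˢ (atTop ×ˢ atTop))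
      (𝓝 (-(Real.pi * Complex.I * iteratedDeriv 2 G x))) := by
  -- The comparison function below has its pole at x + i, which must stay outside the half-plane.
  wlog hδ1 : δ ≤ 1 generalizing δ with H
  · have hsub : ∀ z : ℂ, z.im < 1 → z.im < δ := fun z hz => hz.trans (not_le.1 hδ1)
    exact H one_pos (hd.mono fun z hz => hsub z hz) (fun z hz => hM z (hsub z hz)) le_rfl
  set h := iteratedDeriv 2 G with hh
  -- The subtracted term has the value h x at x and the same quadratic decay as h. Hence F vanishes
  -- at x, F/(z - x) extends holomorphically as `dslope`, and its integral over long segments tends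
  -- to 0.
  set F : ℂ → ℂ := fun z => h z - h x / (1 + Complex.I * (z - x)) ^ 2 with hF
  have hopen : IsOpen {z : ℂ | z.im < δ} := isOpen_lt Complex.continuous_im continuous_const
  have hhd : DifferentiableOn ℂ h {z | z.im < δ} := by
    rw [hh, iteratedDeriv_succ, iteratedDeriv_one]
    exact (hd.deriv hopen).deriv hopen
  have hre : ∀ z : ℂ, (1 + Complex.I * (z - x)).re = 1 - z.im := fun z => by simp; ring
  have hden : ∀ z : ℂ, z.im < δ → (1 : ℂ) + Complex.I * (z - x) ≠ 0 := by
    intro z hz h0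
    have := hre z
    rw [h0, Complex.zero_re] at this
    linarith
  have hFd : DifferentiableOn ℂ F {z | z.im < δ} := by
    refine hhd.sub (DifferentiableOn.div (differentiableOn_const _) (by fun_prop) ?_)
    exact fun z hz => pow_ne_zero _ (hden z hz)
  have hmem : {z : ℂ | z.im < δ} ∈ 𝓝 (x : ℂ) := hopen.mem_nhds (by simpa using hδ)
  have hkd : DifferentiableOn ℂ (dslope F x) {z | z.im < δ} :=
    (Complex.differentiableOn_dslope hmem).2 hFd
  have hkc : Continuous fun y : ℝ => dslope F x (y : ℂ) :=
    hkd.continuousOn.comp_continuous Complex.continuous_ofReal (fun y => by simpa using hδ)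
  have hM0 : 0 ≤ M := (norm_nonneg _).trans (hM 0 (by simpa using hδ))
  have hbound : ∀ z : ℂ, z.im ≤ 0 → z ≠ x →
      ‖dslope F x z‖ ≤ (8 * M + ‖h x‖) / (δ - z.im) ^ 2 / ‖z - x‖ := by
    intro z hz hzx
    have hFx : F x = 0 := by simp [hF]
    rw [dslope_of_ne _ hzx, slope_def_field, hFx, sub_zero, norm_div]
    gcongr
    have hpos : 0 < δ - z.im := by linarith
    have h1 := norm_iteratedDeriv_two_le_of_lowerHalfPlane hd hM (show z.im < δ by linarith)
    have h2 : ‖h x / (1 + Complex.I * (z - x)) ^ 2‖ ≤ ‖h x‖ / (δ - z.im) ^ 2 := by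
      rw [norm_div, norm_pow]
      gcongr
      calc δ - z.im ≤ 1 - z.im := by linarith
        _ = (1 + Complex.I * (z - x)).re := (hre z).symm
        _ ≤ _ := (le_abs_self _).trans (Complex.abs_re_le_norm _)
    rw [add_div]
    exact (norm_sub_le _ _).trans (add_le_add h1 h2)
  have hlong : Tendsto (fun p : ℝ × ℝ => ∫ y in (x - p.1)..(x + p.2), dslope F x (y : ℂ))
      (atTop ×ˢ atTop) (𝓝 0) := by
    have hz : Tendsto (fun p : ℝ × ℝ => (8 * M + ‖h x‖) / δ * (1 / p.1 + 1 / p.2))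
        (atTop ×ˢ atTop) (𝓝 ((8 * M + ‖h x‖) / δ * (0 + 0))) := by
      refine Tendsto.const_mul _ (Tendsto.add ?_ ?_)
      · exact (tendsto_const_nhds.div_atTop tendsto_id).comp tendsto_fst
      · exact (tendsto_const_nhds.div_atTop tendsto_id).comp tendsto_snd
    rw [add_zero, mul_zero] at hz
    refine squeeze_zero_norm' ?_ hz
    filter_upwards [(eventually_gt_atTop (0 : ℝ)).prod_mk (eventually_gt_atTop (0 : ℝ))] with p hp
    exact norm_integral_real_segment_le hδ (by positivity) hp.1 hp.2 hkd hbound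
  have hshort : Tendsto (fun ε : ℝ => ∫ y in (x - ε)..(x + ε), dslope F x (y : ℂ))
      (𝓝[>] 0) (𝓝 0) := by
    have hc : Continuous fun r : ℝ => ∫ y in x..r, dslope F x (y : ℂ) :=
      intervalIntegral.continuous_primitive (fun a b => hkc.intervalIntegrable a b) x
    have hc2 : Continuous fun ε : ℝ => (∫ y in x..(x + ε), dslope F x (y : ℂ)) -
        ∫ y in x..(x - ε), dslope F x (y : ℂ) :=
      (hc.comp (by fun_prop : Continuous fun ε : ℝ => x + ε)).sub
        (hc.comp (by fun_prop : Continuous fun ε : ℝ => x - ε))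
    have := (hc2.tendsto 0).mono_left (nhdsWithin_le_nhds (s := Set.Ioi 0))
    simp only [add_zero, sub_zero, sub_self] at this
    refine this.congr fun ε => ?_
    rw [intervalIntegral.integral_interval_sub_left (hkc.intervalIntegrable _ _)
      (hkc.intervalIntegrable _ _)]
  have hsum := (((hlong.comp tendsto_snd).sub (hshort.comp tendsto_fst)).add
    (((tendsto_poleComparisonPrimitive_neg_sub.comp tendsto_fst).add
      ((tendsto_poleComparisonPrimitive_atTop.comp (tendsto_snd.comp tendsto_snd)).sub
      (tendsto_poleComparisonPrimitive_atBot.comp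
        (tendsto_neg_atTop_atBot.comp (tendsto_fst.comp tendsto_snd))))).const_mul (h x)) :
    Tendsto _ (𝓝[>] (0 : ℝ) ×ˢ ((atTop : Filter ℝ) ×ˢ (atTop : Filter ℝ))) _)
  -- Only the comparison kernel survives: its arctangent runs from -π/2 to π/2 and produces -πi.
  have hval : (0 : ℂ) - 0 + h x * (0 + (-(Complex.I * (Real.pi / 2 : ℝ)) -
      Complex.I * (Real.pi / 2 : ℝ))) = -(Real.pi * Complex.I * h x) := by
    push_cast
    ring
  rw [hval] at hsum
  refine hsum.congr' ?_
  -- The threshold 1 separates the inner cut from both outer ones, so neither interval of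
  -- integration contains x.
  have hev : ∀ᶠ p : ℝ × ℝ × ℝ in 𝓝[>] (0 : ℝ) ×ˢ (atTop ×ˢ atTop),
      (0 < p.1 ∧ p.1 < 1) ∧ 1 < p.2.1 ∧ 1 < p.2.2 :=
    (show ∀ᶠ ε : ℝ in 𝓝[>] 0, 0 < ε ∧ ε < 1 from Ioo_mem_nhdsGT one_pos).prod_mk
      ((eventually_gt_atTop 1).prod_mk (eventually_gt_atTop 1))
  filter_upwards [hev] with p hp
  obtain ⟨⟨h0, h1⟩, h2, h3⟩ := hp
  have hl : x ∉ Set.uIcc (x - p.2.1) (x - p.1) := by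
    rw [Set.uIcc_of_le (by linarith)]
    exact fun hx => by linarith [hx.2]
  have hr : x ∉ Set.uIcc (x + p.1) (x + p.2.2) := by
    rw [Set.uIcc_of_le (by linarith)]
    exact fun hx => by linarith [hx.1]
  rw [integral_div_sub_eq hl hkc, integral_div_sub_eq hr hkc]
  have hi := fun a b : ℝ => hkc.intervalIntegrable (μ := MeasureTheory.volume) a b
  have hsplit : (∫ y in (x - p.2.1)..(x + p.2.2), dslope F x (y : ℂ)) -
      (∫ y in (x - p.1)..(x + p.1), dslope F x (y : ℂ)) =
      (∫ y in (x - p.2.1)..(x - p.1), dslope F x (y : ℂ)) +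
        ∫ y in (x + p.1)..(x + p.2.2), dslope F x (y : ℂ) := by
    rw [← intervalIntegral.integral_add_adjacent_intervals (hi (x - p.2.1) (x - p.1))
      (hi (x - p.1) (x + p.2.2)), ← intervalIntegral.integral_add_adjacent_intervals
      (hi (x - p.1) (x + p.1)) (hi (x + p.1) (x + p.2.2))]
    ring
  simp only [Function.comp]
  rw [hsplit]
  have s1 : x - p.1 - x = -p.1 := by ring
  have s2 : x - p.2.1 - x = -p.2.1 := by ring
  have s3 : x + p.1 - x = p.1 := by ring
  have s4 : x + p.2.2 - x = p.2.2 := by ring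
  rw [s1, s2, s3, s4]
  ring

lemma hasDerivAt_im_comp_ofReal {G : ℂ → ℂ} {g : ℂ} {x : ℝ} (hG : HasDerivAt G g x) :
    HasDerivAt (fun s : ℝ => (G s).im) g.im x :=
  Complex.imCLM.hasFDerivAt.comp_hasDerivAt x hG.comp_ofReal

/-- The Hilbert transform of the second derivative of `a + 2 Im G`, for `G` bounded and
holomorphic in a half-plane `Im z < δ`, `δ > 0`. -/
theorem hasHilbertTransformAt_iteratedDeriv_two_im {G : ℂ → ℂ} {δ M : ℝ} (hδ : 0 < δ)
    (hd : DifferentiableOn ℂ G {z | z.im < δ}) (hM : ∀ z : ℂ, z.im < δ → ‖G z‖ ≤ M) (a x : ℝ) :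
    HasHilbertTransformAt (fun y => iteratedDeriv 2 (fun s : ℝ => a + 2 * (G s).im) y) x
      (-(2 * (iteratedDeriv 2 G x).re)) := by
  have hopen : IsOpen {z : ℂ | z.im < δ} := isOpen_lt Complex.continuous_im continuous_const
  have hmem : ∀ y : ℝ, {z : ℂ | z.im < δ} ∈ 𝓝 (y : ℂ) := fun y =>
    hopen.mem_nhds (by simpa using hδ)
  have hd1 := hd.deriv hopen
  have hd2 := hd1.deriv hopen
  have hder1 : deriv (fun s : ℝ => a + 2 * (G s).im) = fun s : ℝ => 2 * (deriv G s).im :=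
    funext fun y => ((hasDerivAt_im_comp_ofReal
      (hd.differentiableAt (hmem y)).hasDerivAt).const_mul 2 |>.const_add a).deriv
  have hder2 : (fun y => iteratedDeriv 2 (fun s : ℝ => a + 2 * (G s).im) y) =
      fun s : ℝ => 2 * (iteratedDeriv 2 G s).im := by
    funext y
    rw [iteratedDeriv_succ, iteratedDeriv_one, iteratedDeriv_succ, iteratedDeriv_one, hder1]
    exact ((hasDerivAt_im_comp_ofReal
      (hd1.differentiableAt (hmem y)).hasDerivAt).const_mul 2).deriv
  have hcont : Continuous fun y : ℝ => iteratedDeriv 2 G (y : ℂ) := by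
    rw [iteratedDeriv_succ, iteratedDeriv_one]
    exact hd2.continuousOn.comp_continuous Complex.continuous_ofReal (fun y => by simpa using hδ)
  have hlim := (Complex.continuous_im.tendsto _).comp
    (tendsto_principalValue_iteratedDeriv_two hδ hd hM x)
  have hlim2 := hlim.const_mul (1 / Real.pi * 2)
  have hder3 : ∀ y : ℝ, iteratedDeriv 2 (fun s : ℝ => a + 2 * (G s).im) y =
      2 * (iteratedDeriv 2 G y).im := fun y => congrFun hder2 y
  simp only [HasHilbertTransformAt, hder3]
  have hval : 1 / Real.pi * 2 * (-(Real.pi * Complex.I * iteratedDeriv 2 G x)).im =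
      -(2 * (iteratedDeriv 2 G x).re) := by
    simp
    field_simp
  rw [hval] at hlim2
  refine hlim2.congr' ?_
  have him : ∀ u v : ℝ, x ∉ Set.uIcc u v →
      (∫ y in u..v, 2 * (iteratedDeriv 2 G (y : ℂ)).im / (y - x)) =
        2 * (∫ y in u..v, iteratedDeriv 2 G (y : ℂ) / (y - x)).im := by
    intro u v hx
    have hint : IntervalIntegrable (fun y : ℝ => iteratedDeriv 2 G (y : ℂ) / (y - x))
        MeasureTheory.volume u v := by
      refine ContinuousOn.intervalIntegrable (hcont.continuousOn.div (by fun_prop) ?_)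
      intro y hy h0
      exact hx (by rwa [Complex.ofReal_inj.1 (sub_eq_zero.1 h0)] at hy)
    have := Complex.imCLM.intervalIntegral_comp_comm hint
    simp only [Complex.imCLM_apply] at this
    rw [← this, ← intervalIntegral.integral_const_mul]
    refine intervalIntegral.integral_congr fun y _ => ?_
    rw [← Complex.ofReal_sub, Complex.div_ofReal_im]
    ring
  have hev : ∀ᶠ p : ℝ × ℝ × ℝ in 𝓝[>] (0 : ℝ) ×ˢ (atTop ×ˢ atTop),
      (0 < p.1 ∧ p.1 < 1) ∧ 1 < p.2.1 ∧ 1 < p.2.2 :=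
    (show ∀ᶠ ε : ℝ in 𝓝[>] 0, 0 < ε ∧ ε < 1 from Ioo_mem_nhdsGT one_pos).prod_mk
      ((eventually_gt_atTop 1).prod_mk (eventually_gt_atTop 1))
  filter_upwards [hev] with p hp
  obtain ⟨⟨h0, h1⟩, h2, h3⟩ := hp
  have hl : x ∉ Set.uIcc (x - p.2.1) (x - p.1) := by
    rw [Set.uIcc_of_le (by linarith)]
    exact fun hx => by linarith [hx.2]
  have hr : x ∉ Set.uIcc (x + p.1) (x + p.2.2) := by
    rw [Set.uIcc_of_le (by linarith)]
    exact fun hx => by linarith [hx.1]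
  simp only [Function.comp]
  rw [him _ _ hl, him _ _ hr, Complex.add_im]
  ring

/-! ### Derivatives of f along space and time. -/

open Complex in
/-- The derivative of `f` along `∂ₓ`, with `ξₓ = ηₓ = 1`. -/
noncomputable def breatherFx (k φ c : ℝ) (ξ η : ℂ) : ℂ :=
  -(I * c) - (I * c + I * k * (breatherBeta k φ c + 1 + I * c * η)) * exp (I * k * ξ + φ)

open Complex in
/-- The derivative of `f` along `∂ₓ²`. -/
noncomputable def breatherFxx (k φ c : ℝ) (ξ η : ℂ) : ℂ :=
  (2 * c * k + k ^ 2 * (breatherBeta k φ c + 1 + I * c * η)) * exp (I * k * ξ + φ)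

open Complex in
/-- The derivative of `f` along `∂ₜ`, with `ξₜ = -c₀`, `ηₜ = -c`. -/
noncomputable def breatherFt (k φ c : ℝ) (ξ η : ℂ) : ℂ :=
  I * c ^ 2 + (I * c ^ 2 + I * k * waveSpeed k φ * (breatherBeta k φ c + 1 + I * c * η)) *
    exp (I * k * ξ + φ)

open Complex in
/-- The derivative of `f` along `∂ₜ∂ₓ`. -/
noncomputable def breatherFxt2 (k φ c : ℝ) (ξ η : ℂ) : ℂ :=
  -(c ^ 2 * k + waveSpeed k φ * k * c +
    k ^ 2 * waveSpeed k φ * (breatherBeta k φ c + 1 + I * c * η)) * exp (I * k * ξ + φ)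

section Curves

variable {k φ c : ℝ} {𝕜 : Type*} [NontriviallyNormedField 𝕜] [NormedAlgebra 𝕜 ℂ]
  {ξ η : 𝕜 → ℂ} {ξ' η' : ℂ} {s : 𝕜}

/-- The parameter field is left general: 𝕜 = ℂ serves holomorphy in z, 𝕜 = ℝ the derivatives in real
x and t. -/
lemma hasDerivAt_breather_exp (hξ : HasDerivAt ξ ξ' s) :
    HasDerivAt (fun s => Complex.exp (Complex.I * k * ξ s + φ))
      (Complex.exp (Complex.I * k * ξ s + φ) * (Complex.I * k * ξ')) s :=
  ((hξ.const_mul (Complex.I * k)).add_const (φ : ℂ)).cexp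

lemma hasDerivAt_breatherF (hξ : HasDerivAt ξ ξ' s) (hη : HasDerivAt η η' s) :
    HasDerivAt (fun s => breatherF k φ c (ξ s) (η s))
      (-(Complex.I * c * η') * (1 + Complex.exp (Complex.I * k * ξ s + φ)) -
        (breatherBeta k φ c + 1 + Complex.I * c * η s) * (Complex.I * k * ξ') *
          Complex.exp (Complex.I * k * ξ s + φ)) s := by
  have hW := hasDerivAt_breather_exp (k := k) (φ := φ) hξ
  refine (((hW.const_sub 1).const_mul (breatherBeta k φ c : ℂ)).sub
    (((hη.const_mul (Complex.I * c)).const_add 1).mul (hW.const_add 1))).congr_deriv ?_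
  ring

lemma hasDerivAt_breatherFx (hξ : HasDerivAt ξ ξ' s) (hη : HasDerivAt η η' s) :
    HasDerivAt (fun s => breatherFx k φ c (ξ s) (η s))
      ((k * c * η' - (Complex.I * c + Complex.I * k *
        (breatherBeta k φ c + 1 + Complex.I * c * η s)) * (Complex.I * k * ξ')) *
          Complex.exp (Complex.I * k * ξ s + φ)) s := by
  have hW := hasDerivAt_breather_exp (k := k) (φ := φ) hξ
  refine ((((((hη.const_mul (Complex.I * c)).const_add (breatherBeta k φ c + 1 : ℂ)).const_mul
    (Complex.I * k)).const_add (Complex.I * c)).mul hW).const_sub (-(Complex.I * c))).congr_deriv ?_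
  linear_combination -(k * c * η' * Complex.exp (Complex.I * k * ξ s + φ)) * Complex.I_sq

lemma hasDerivAt_breatherFt (hξ : HasDerivAt ξ ξ' s) (hη : HasDerivAt η η' s) :
    HasDerivAt (fun s => breatherFt k φ c (ξ s) (η s))
      ((-(k * waveSpeed k φ * c * η') + (Complex.I * c ^ 2 + Complex.I * k * waveSpeed k φ *
        (breatherBeta k φ c + 1 + Complex.I * c * η s)) * (Complex.I * k * ξ')) *
          Complex.exp (Complex.I * k * ξ s + φ)) s := by
  have hW := hasDerivAt_breather_exp (k := k) (φ := φ) hξ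
  refine ((((((hη.const_mul (Complex.I * c)).const_add (breatherBeta k φ c + 1 : ℂ)).const_mul
    (Complex.I * k * waveSpeed k φ)).const_add (Complex.I * c ^ 2)).mul hW).const_add
      (Complex.I * c ^ 2)).congr_deriv ?_
  linear_combination (k * waveSpeed k φ * c * η' * Complex.exp (Complex.I * k * ξ s + φ)) *
    Complex.I_sq

lemma hasDerivAt_breatherF_space (hξ : HasDerivAt ξ 1 s) (hη : HasDerivAt η 1 s) :
    HasDerivAt (fun s => breatherF k φ c (ξ s) (η s)) (breatherFx k φ c (ξ s) (η s)) s := by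
  refine (hasDerivAt_breatherF hξ hη).congr_deriv ?_
  rw [breatherFx]
  ring

lemma hasDerivAt_breatherFx_space (hξ : HasDerivAt ξ 1 s) (hη : HasDerivAt η 1 s) :
    HasDerivAt (fun s => breatherFx k φ c (ξ s) (η s)) (breatherFxx k φ c (ξ s) (η s)) s := by
  refine (hasDerivAt_breatherFx hξ hη).congr_deriv ?_
  rw [breatherFxx]
  linear_combination -(k * c + k ^ 2 * (breatherBeta k φ c + 1 + Complex.I * c * η s)) *
    Complex.exp (Complex.I * k * ξ s + φ) * Complex.I_sq

lemma hasDerivAt_breatherFt_space (hξ : HasDerivAt ξ 1 s) (hη : HasDerivAt η 1 s) :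
    HasDerivAt (fun s => breatherFt k φ c (ξ s) (η s)) (breatherFxt2 k φ c (ξ s) (η s)) s := by
  refine (hasDerivAt_breatherFt hξ hη).congr_deriv ?_
  rw [breatherFxt2]
  linear_combination (k * c ^ 2 + k ^ 2 * waveSpeed k φ *
    (breatherBeta k φ c + 1 + Complex.I * c * η s)) *
    Complex.exp (Complex.I * k * ξ s + φ) * Complex.I_sq

lemma hasDerivAt_breatherF_time (hξ : HasDerivAt ξ (-(waveSpeed k φ : ℂ)) s)
    (hη : HasDerivAt η (-(c : ℂ)) s) :
    HasDerivAt (fun s => breatherF k φ c (ξ s) (η s)) (breatherFt k φ c (ξ s) (η s)) s := by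
  refine (hasDerivAt_breatherF hξ hη).congr_deriv ?_
  rw [breatherFt]
  ring

/-- The same mixed derivative as in `hasDerivAt_breatherFt_space`; this lets ∂ₓ(f_t/f) be exchanged
with ∂ₜ(f_x/f). -/
lemma hasDerivAt_breatherFx_time (hξ : HasDerivAt ξ (-(waveSpeed k φ : ℂ)) s)
    (hη : HasDerivAt η (-(c : ℂ)) s) :
    HasDerivAt (fun s => breatherFx k φ c (ξ s) (η s)) (breatherFxt2 k φ c (ξ s) (η s)) s := by
  refine (hasDerivAt_breatherFx hξ hη).congr_deriv ?_
  rw [breatherFxt2]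
  linear_combination (c * k * waveSpeed k φ + k ^ 2 * waveSpeed k φ *
    (breatherBeta k φ c + 1 + Complex.I * c * η s)) *
    Complex.exp (Complex.I * k * ξ s + φ) * Complex.I_sq

end Curves

/-! ### Zero-free half-plane and bounds for f. -/

lemma breatherF_eq (k φ c : ℝ) (ξ η : ℂ) : breatherF k φ c ξ η =
    (breatherBeta k φ c - 1 - Complex.I * c * η) -
      (breatherBeta k φ c + 1 + Complex.I * c * η) * Complex.exp (Complex.I * k * ξ + φ) := by
  rw [breatherF]
  ring

lemma breatherBeta_pos {k φ c : ℝ} (hk : 0 < k) (hc : 0 < c)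
    (h : waveSpeed k φ + k < c ∨ c < waveSpeed k φ - k) : 0 < breatherBeta k φ c := by
  refine div_pos (by positivity) ?_
  rcases h with h | h
  · have : 0 < (c - waveSpeed k φ - k) * (c - waveSpeed k φ + k) :=
      mul_pos (by linarith) (by linarith)
    linarith
  · have : 0 < (waveSpeed k φ - c - k) * (waveSpeed k φ - c + k) :=
      mul_pos (by linarith) (by linarith)
    linarith

lemma breatherBeta_mul {k φ c : ℝ} (hk : 0 < k)
    (h : waveSpeed k φ + k < c ∨ c < waveSpeed k φ - k) :
    breatherBeta k φ c * ((c - waveSpeed k φ) ^ 2 - k ^ 2) = 2 * c * k := by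
  refine div_mul_cancel₀ _ (ne_of_gt ?_)
  rcases h with h | h
  · have : 0 < (c - waveSpeed k φ - k) * (c - waveSpeed k φ + k) :=
      mul_pos (by linarith) (by linarith)
    linarith
  · have : 0 < (waveSpeed k φ - c - k) * (waveSpeed k φ - c + k) :=
      mul_pos (by linarith) (by linarith)
    linarith

/-- Turns coth φ into a polynomial relation in e^φ, the form used in the bilinear identity. -/
lemma waveSpeed_mul {k φ : ℝ} (hφ : 0 < φ) :
    waveSpeed k φ * (Real.exp φ ^ 2 - 1) = k * (Real.exp φ ^ 2 + 1) := by
  have h1 : Real.sinh φ ≠ 0 := (Real.sinh_pos_iff.2 hφ).ne'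
  have h2 : Real.exp φ * Real.exp (-φ) = 1 := by rw [← Real.exp_add, add_neg_cancel, Real.exp_zero]
  have e1 : Real.exp φ ^ 2 - 1 = 2 * Real.exp φ * Real.sinh φ := by
    rw [Real.sinh_eq]
    linear_combination h2
  have e2 : Real.exp φ ^ 2 + 1 = 2 * Real.exp φ * Real.cosh φ := by
    rw [Real.cosh_eq]
    linear_combination -h2
  rw [waveSpeed, e1, e2]
  field_simp

lemma normSq_sub_one_sub (b c : ℝ) (η : ℂ) :
    Complex.normSq ((b : ℂ) - 1 - Complex.I * c * η) =
      (b - 1 + c * η.im) ^ 2 + (c * η.re) ^ 2 := by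
  simp [Complex.normSq_apply]
  ring

lemma normSq_add_one_add (b c : ℝ) (η : ℂ) :
    Complex.normSq ((b : ℂ) + 1 + Complex.I * c * η) =
      (b + 1 - c * η.im) ^ 2 + (c * η.re) ^ 2 := by
  simp [Complex.normSq_apply]
  ring

lemma norm_breather_exp (k φ : ℝ) (ξ : ℂ) :
    ‖Complex.exp (Complex.I * k * ξ + φ)‖ = Real.exp (φ - k * ξ.im) := by
  rw [Complex.norm_exp]
  congr 1
  simp
  ring

/-- The squared moduli differ by 4b(1 - c Im η). -/
lemma norm_sub_one_sub_le {b c : ℝ} {η : ℂ} (hb : 0 < b) (hη : c * η.im ≤ 1) :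
    ‖(b : ℂ) - 1 - Complex.I * c * η‖ ≤ ‖(b : ℂ) + 1 + Complex.I * c * η‖ := by
  rw [← sq_le_sq₀ (norm_nonneg _) (norm_nonneg _), ← Complex.normSq_eq_norm_sq,
    ← Complex.normSq_eq_norm_sq, normSq_sub_one_sub, normSq_add_one_add]
  nlinarith [mul_nonneg hb.le (sub_nonneg.2 hη)]

lemma le_norm_add_one_add {b c : ℝ} {η : ℂ} (hη : c * η.im ≤ 1) :
    b ≤ ‖(b : ℂ) + 1 + Complex.I * c * η‖ := by
  refine le_trans ?_ ((le_abs_self _).trans (Complex.abs_re_le_norm _))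
  simp
  linarith

/-- Lower bound for `f` below the line where `|β - 1 - icη| ≤ |β + 1 + icη|`. -/
lemma le_norm_breatherF {k φ c : ℝ} {ξ η : ℂ} (hb : 0 < breatherBeta k φ c)
    (hη : c * η.im ≤ 1) :
    ‖(breatherBeta k φ c : ℂ) + 1 + Complex.I * c * η‖ *
      (Real.exp (φ - k * ξ.im) - 1) ≤ ‖breatherF k φ c ξ η‖ := by
  rw [breatherF_eq, norm_sub_rev]
  refine le_trans ?_ (norm_sub_norm_le _ _)
  rw [norm_mul, norm_breather_exp]
  linarith [norm_sub_one_sub_le hb hη]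

lemma breatherF_ne_zero {k φ c : ℝ} {ξ η : ℂ} (hb : 0 < breatherBeta k φ c)
    (hη : c * η.im ≤ 1) (hξ : k * ξ.im < φ) : breatherF k φ c ξ η ≠ 0 := by
  rw [← norm_pos_iff]
  refine lt_of_lt_of_le (mul_pos (hb.trans_le (le_norm_add_one_add hη)) ?_)
    (le_norm_breatherF hb hη)
  rw [sub_pos, Real.one_lt_exp_iff]
  linarith

/-- A bound for `∂ₓ log f` in a half-plane. -/
lemma norm_breatherFx_div_le {k φ c : ℝ} {ξ η : ℂ} (hk : 0 < k) (hφ : 0 < φ) (hc : 0 < c)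
    (hb : 0 < breatherBeta k φ c) (hη : c * η.im ≤ 1) (hξ : k * ξ.im ≤ φ / 2) :
    ‖breatherFx k φ c ξ η / breatherF k φ c ξ η‖ ≤
      (2 * c / breatherBeta k φ c + k) / (1 - Real.exp (-(φ / 2))) := by
  set b := breatherBeta k φ c
  set w := Real.exp (φ - k * ξ.im) with hw
  set n := ‖(b : ℂ) + 1 + Complex.I * c * η‖ with hn
  have hbn : b ≤ n := le_norm_add_one_add hη
  have hn0 : 0 < n := hb.trans_le hbn
  have hr : 0 < 1 - Real.exp (-(φ / 2)) := by
    rw [sub_pos, Real.exp_lt_one_iff]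
    linarith
  -- Stopping at φ/2 instead of φ gives w ≥ e^{φ/2}, so w - 1 is at least a fixed fraction of w and
  -- the bound is uniform as w and n grow.
  have hwr : 1 ≤ Real.exp (-(φ / 2)) * w := by
    rw [hw, ← Real.exp_add, Real.one_le_exp_iff]
    linarith
  have hw1 : 1 ≤ w := by
    rw [hw, Real.one_le_exp_iff]
    linarith
  have hF : n * (w * (1 - Real.exp (-(φ / 2)))) ≤ ‖breatherF k φ c ξ η‖ := by
    refine le_trans ?_ (le_norm_breatherF hb hη)
    gcongr
    linarith
  have hFx : ‖breatherFx k φ c ξ η‖ ≤ c + (c + k * n) * w := by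
    rw [breatherFx]
    refine (norm_sub_le _ _).trans ?_
    rw [norm_neg, norm_mul, norm_mul, norm_breather_exp, Complex.norm_I, Complex.norm_real,
      Real.norm_of_nonneg hc.le, one_mul]
    gcongr
    refine (norm_add_le _ _).trans (le_of_eq ?_)
    rw [norm_mul, norm_mul, norm_mul, Complex.norm_I, Complex.norm_real, Complex.norm_real,
      Real.norm_of_nonneg hc.le, Real.norm_of_nonneg hk.le, one_mul, one_mul]
  rw [norm_div]
  have hpos : 0 < n * (w * (1 - Real.exp (-(φ / 2)))) := by positivity
  refine (div_le_div₀ (by positivity) hFx hpos hF).trans ?_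
  rw [div_le_div_iff₀ hpos hr]
  have key : c + (c + k * n) * w ≤ (2 * c / b + k) * (n * w) := by
    have h1 : c ≤ c / b * (n * w) := by
      rw [div_mul_eq_mul_div, le_div_iff₀ hb]
      gcongr
      nlinarith
    have h2 : c * w ≤ c / b * (n * w) := by
      rw [div_mul_eq_mul_div, le_div_iff₀ hb, mul_assoc, mul_comm w b]
      gcongr
    have h3 : (2 * c / b + k) * (n * w) = c / b * (n * w) + c / b * (n * w) + k * n * w := by ring
    linarith
  calc (c + (c + k * n) * w) * (1 - Real.exp (-(φ / 2)))
      ≤ (2 * c / b + k) * (n * w) * (1 - Real.exp (-(φ / 2))) := by gcongr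
    _ = _ := by ring

/-! ### Conjugation and the bilinear identity. -/

/-- Reflection in the real axis carries zeros of f to zeros of f', and on the real line f'/f becomes
a phase factor times conj f / f. -/
lemma breatherF'_eq_conj (k φ c : ℝ) (ξ η : ℂ) : breatherF' k φ c ξ η =
    -Complex.exp (Complex.I * k * ξ - φ) *
      (starRingEnd ℂ) (breatherF k φ c ((starRingEnd ℂ) ξ) ((starRingEnd ℂ) η)) := by
  have h : Complex.exp (Complex.I * k * ξ - φ) * Complex.exp (-(Complex.I * k * ξ) + φ) = 1 := by
    rw [← Complex.exp_add]
    simp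
  rw [breatherF', breatherF]
  simp only [map_sub, map_mul, map_add, map_one, Complex.conj_ofReal, Complex.conj_I,
    ← Complex.exp_conj, Complex.conj_conj, neg_mul]
  linear_combination (-(breatherBeta k φ c : ℂ) - (1 - Complex.I * c * η)) * h

lemma conj_breatherF (k φ c ξ η : ℝ) : (starRingEnd ℂ) (breatherF k φ c ξ η) =
    (breatherBeta k φ c - 1 + Complex.I * c * η) -
      (breatherBeta k φ c + 1 - Complex.I * c * η) * Complex.exp (-(Complex.I * k * ξ) + φ) := by
  rw [breatherF_eq]
  simp only [map_sub, map_mul, map_add, map_one, Complex.conj_ofReal, Complex.conj_I,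
    ← Complex.exp_conj, neg_mul]
  ring

lemma conj_breatherFx (k φ c ξ η : ℝ) : (starRingEnd ℂ) (breatherFx k φ c ξ η) =
    Complex.I * c + (Complex.I * c + Complex.I * k *
      (breatherBeta k φ c + 1 - Complex.I * c * η)) * Complex.exp (-(Complex.I * k * ξ) + φ) := by
  rw [breatherFx]
  simp only [map_sub, map_mul, map_add, map_one, map_neg, Complex.conj_ofReal, Complex.conj_I,
    ← Complex.exp_conj, neg_mul]
  ring

lemma conj_breatherFxx (k φ c ξ η : ℝ) : (starRingEnd ℂ) (breatherFxx k φ c ξ η) =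
    (2 * c * k + k ^ 2 * (breatherBeta k φ c + 1 - Complex.I * c * η)) *
      Complex.exp (-(Complex.I * k * ξ) + φ) := by
  rw [breatherFxx]
  simp only [map_mul, map_add, map_one, map_pow, Complex.conj_ofReal,
    Complex.conj_I, ← Complex.exp_conj, neg_mul, map_ofNat]
  ring

lemma conj_breatherFt (k φ c ξ η : ℝ) : (starRingEnd ℂ) (breatherFt k φ c ξ η) =
    -(Complex.I * c ^ 2) - (Complex.I * c ^ 2 + Complex.I * k * waveSpeed k φ *
      (breatherBeta k φ c + 1 - Complex.I * c * η)) * Complex.exp (-(Complex.I * k * ξ) + φ) := by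
  rw [breatherFt]
  simp only [map_mul, map_add, map_one, map_pow, Complex.conj_ofReal,
    Complex.conj_I, ← Complex.exp_conj, neg_mul]
  ring

lemma breatherDen_mul (k φ c ξ η : ℝ) : (breatherDen k φ c ξ η : ℂ) * (2 * Complex.exp φ) =
    breatherF k φ c ξ η * (starRingEnd ℂ) (breatherF k φ c ξ η) := by
  have hp : Complex.exp φ * Complex.exp (-φ) = 1 := by rw [← Complex.exp_add]; simp
  have hE : Complex.exp (Complex.I * k * ξ) * Complex.exp (-(Complex.I * k * ξ)) = 1 := by
    rw [← Complex.exp_add]; simp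
  rw [conj_breatherF, breatherF_eq, breatherDen, Complex.exp_add, Complex.exp_add]
  push_cast
  rw [Complex.cos, Complex.sin, Complex.cosh, Complex.sinh,
    show (k : ℂ) * ξ * Complex.I = Complex.I * k * ξ by ring,
    show -((k : ℂ) * ξ) * Complex.I = -(Complex.I * k * ξ) by ring]
  generalize Complex.exp (Complex.I * k * ξ) = E at *
  generalize Complex.exp (-(Complex.I * k * ξ)) = E' at *
  generalize Complex.exp (φ : ℂ) = p at *
  generalize Complex.exp (-(φ : ℂ)) = p' at *
  generalize (breatherBeta k φ c : ℂ) = b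
  linear_combination (norm := skip) ((1 + b ^ 2 + (c : ℂ) ^ 2 * η ^ 2) - 2 * b) * hp -
    p ^ 2 * ((b + 1) ^ 2 + (c : ℂ) ^ 2 * η ^ 2) * hE
  ring_nf
  simp only [Complex.I_sq]
  ring

/-- The right side is -k|f|² + 2 Im(f_x conj f); dividing by |f|² gives u = -k + 2 Im G. -/
lemma breatherNum_mul (k φ c ξ η : ℝ) : (breatherNum k φ c ξ η : ℂ) * (2 * Complex.exp φ) =
    -(k : ℂ) * (breatherF k φ c ξ η * (starRingEnd ℂ) (breatherF k φ c ξ η)) -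
      Complex.I * (breatherFx k φ c ξ η * (starRingEnd ℂ) (breatherF k φ c ξ η) -
        (starRingEnd ℂ) (breatherFx k φ c ξ η) * breatherF k φ c ξ η) := by
  have hp : Complex.exp φ * Complex.exp (-φ) = 1 := by rw [← Complex.exp_add]; simp
  have hE : Complex.exp (Complex.I * k * ξ) * Complex.exp (-(Complex.I * k * ξ)) = 1 := by
    rw [← Complex.exp_add]; simp
  rw [conj_breatherF, conj_breatherFx, breatherF_eq, breatherFx, breatherNum, Complex.exp_add,
    Complex.exp_add]
  push_cast
  rw [Complex.cos, Complex.cosh, Complex.sinh,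
    show (k : ℂ) * ξ * Complex.I = Complex.I * k * ξ by ring,
    show -((k : ℂ) * ξ) * Complex.I = -(Complex.I * k * ξ) by ring]
  generalize Complex.exp (Complex.I * k * ξ) = E at *
  generalize Complex.exp (-(Complex.I * k * ξ)) = E' at *
  generalize Complex.exp (φ : ℂ) = p at *
  generalize Complex.exp (-(φ : ℂ)) = p' at *
  generalize (breatherBeta k φ c : ℂ) = b
  linear_combination (norm := skip) (2 * (c + k * b) -
    (k * (1 + b ^ 2 + (c : ℂ) ^ 2 * η ^ 2) + 2 * b * c)) * hp -
    p ^ 2 * (k * ((b + 1) ^ 2 + (c : ℂ) ^ 2 * η ^ 2) + 2 * c * (b + 1)) * hE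
  ring_nf
  simp only [Complex.I_sq, Complex.I_pow_three, Complex.I_pow_four]
  ring

/-- The bilinear form of the equation. -/
lemma breather_bilinear {k φ c : ℝ} (hk : 0 < k) (hφ : 0 < φ)
    (h : waveSpeed k φ + k < c ∨ c < waveSpeed k φ - k) (ξ η : ℝ) :
    (k * waveSpeed k φ + k ^ 2 : ℂ) *
        (breatherF k φ c ξ η * (starRingEnd ℂ) (breatherF k φ c ξ η)) -
      Complex.I * (breatherFt k φ c ξ η * (starRingEnd ℂ) (breatherF k φ c ξ η) -
        (starRingEnd ℂ) (breatherFt k φ c ξ η) * breatherF k φ c ξ η) +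
      2 * Complex.I * k * (breatherFx k φ c ξ η * (starRingEnd ℂ) (breatherF k φ c ξ η) -
        (starRingEnd ℂ) (breatherFx k φ c ξ η) * breatherF k φ c ξ η) +
      2 * (breatherFx k φ c ξ η * (starRingEnd ℂ) (breatherFx k φ c ξ η)) -
      breatherFxx k φ c ξ η * (starRingEnd ℂ) (breatherF k φ c ξ η) -
      (starRingEnd ℂ) (breatherFxx k φ c ξ η) * breatherF k φ c ξ η = 0 := by
  have hE : Complex.exp (Complex.I * k * ξ) * Complex.exp (-(Complex.I * k * ξ)) = 1 := by
    rw [← Complex.exp_add]; simp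
  have h1 : (waveSpeed k φ : ℂ) * (Complex.exp φ ^ 2 - 1) = k * (Complex.exp φ ^ 2 + 1) := by
    exact_mod_cast waveSpeed_mul (k := k) hφ
  have h2 : (breatherBeta k φ c : ℂ) * ((c - waveSpeed k φ) ^ 2 - k ^ 2) = 2 * c * k := by
    exact_mod_cast breatherBeta_mul hk h
  rw [conj_breatherF, conj_breatherFx, conj_breatherFxx, conj_breatherFt, breatherF_eq, breatherFx,
    breatherFxx, breatherFt, Complex.exp_add, Complex.exp_add]
  generalize Complex.exp (Complex.I * k * ξ) = E at *
  generalize Complex.exp (-(Complex.I * k * ξ)) = E' at *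
  generalize Complex.exp (φ : ℂ) = p at *
  generalize (breatherBeta k φ c : ℂ) = b at *
  generalize (waveSpeed k φ : ℂ) = v at *
  have hsq := Complex.I_sq
  generalize Complex.I = i at *
  have hI3 : i ^ 3 = -i := by linear_combination i * hsq
  have hI4 : i ^ 4 = 1 := by linear_combination (i ^ 2 - 1) * hsq
  -- The weights of the relations for β and c₀. Normalization is postponed because powers of i and
  -- the products E E' = 1 still have to be reduced.
  linear_combination (norm := skip) (-2 * (p ^ 2 - 1)) * h2 +
    (-k * ((c : ℂ) ^ 2 * η ^ 2 + b ^ 2 + 1) + 2 * b * v - 4 * c * b) * h1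
  ring_nf
  simp only [hsq, hI3, hI4]
  ring_nf
  have : E' * E = 1 := by rw [mul_comm]; exact hE
  grind

/-! ### The breather as a solution. -/

/-- `∂ₓ log f` as a function of `(z, t)`. -/
noncomputable def breatherLogDeriv (k φ c ξ₀ η₀ : ℝ) (z : ℂ) (t : ℝ) : ℂ :=
  breatherFx k φ c (z - waveSpeed k φ * t - ξ₀) (z - c * t - η₀) / breatherFxt k φ c ξ₀ η₀ z t

lemma ofReal_im_eq_conj (w : ℂ) : (w.im : ℂ) = -(Complex.I / 2) * (w - (starRingEnd ℂ) w) := by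
  rw [Complex.sub_conj]
  push_cast
  linear_combination (w.im : ℂ) * Complex.I_sq

lemma breatherNum_div_breatherDen {k φ c ξ η : ℝ} (hf : breatherF k φ c ξ η ≠ 0) :
    breatherNum k φ c ξ η / breatherDen k φ c ξ η =
      -k + 2 * (breatherFx k φ c ξ η / breatherF k φ c ξ η).im := by
  have hF : (starRingEnd ℂ) (breatherF k φ c ξ η) ≠ 0 := (map_ne_zero _).2 hf
  have h1 := breatherDen_mul k φ c ξ η
  have h2 := breatherNum_mul k φ c ξ η
  have hp : (2 : ℂ) * Complex.exp φ ≠ 0 := mul_ne_zero two_ne_zero (Complex.exp_ne_zero _)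
  apply Complex.ofReal_injective
  push_cast
  rw [ofReal_im_eq_conj, map_div₀, ← mul_div_mul_right _ _ hp, h1, h2]
  field_simp
  ring

/-- The equation integrated once in x, obtained from the bilinear identity on division by |f|². The
quadratic terms of u² and -2 Re G' combine through 4(Im G)² + 2 Re G² = 2|G|². -/
lemma breather_riccati {k φ c : ℝ} (hk : 0 < k) (hφ : 0 < φ)
    (h : waveSpeed k φ + k < c ∨ c < waveSpeed k φ - k) {ξ η : ℝ}
    (hf : breatherF k φ c ξ η ≠ 0) :
    k * waveSpeed k φ + 2 * (breatherFt k φ c ξ η / breatherF k φ c ξ η).im +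
      (-k + 2 * (breatherFx k φ c ξ η / breatherF k φ c ξ η).im) ^ 2 -
      2 * ((breatherFxx k φ c ξ η * breatherF k φ c ξ η -
        breatherFx k φ c ξ η * breatherFx k φ c ξ η) / breatherF k φ c ξ η ^ 2).re = 0 := by
  have hF : (starRingEnd ℂ) (breatherF k φ c ξ η) ≠ 0 := (map_ne_zero _).2 hf
  have hb := breather_bilinear hk hφ h ξ η
  apply Complex.ofReal_injective
  push_cast
  rw [ofReal_im_eq_conj, ofReal_im_eq_conj, Complex.re_eq_add_conj]
  simp only [map_div₀, map_sub, map_mul, map_pow]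
  generalize (starRingEnd ℂ) (breatherF k φ c ξ η) = F at *
  generalize breatherF k φ c ξ η = f at *
  generalize (starRingEnd ℂ) (breatherFx k φ c ξ η) = Fx at *
  generalize breatherFx k φ c ξ η = fx at *
  generalize (starRingEnd ℂ) (breatherFxx k φ c ξ η) = Fxx at *
  generalize breatherFxx k φ c ξ η = fxx at *
  generalize (starRingEnd ℂ) (breatherFt k φ c ξ η) = Ft at *
  generalize breatherFt k φ c ξ η = ft at *
  field_simp
  linear_combination f * F * hb + (fx * F - Fx * f) ^ 2 * Complex.I_sq

section Solution

variable {k φ c : ℝ} (ξ₀ η₀ : ℝ)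

lemma breatherFxt_ofReal (x t : ℝ) : breatherFxt k φ c ξ₀ η₀ x t =
    breatherF k φ c ((x - waveSpeed k φ * t - ξ₀ : ℝ) : ℂ) ((x - c * t - η₀ : ℝ) : ℂ) := by
  rw [breatherFxt]
  push_cast
  rfl

lemma breatherLogDeriv_ofReal (x t : ℝ) : breatherLogDeriv k φ c ξ₀ η₀ x t =
    breatherFx k φ c ((x - waveSpeed k φ * t - ξ₀ : ℝ) : ℂ) ((x - c * t - η₀ : ℝ) : ℂ) /
    breatherF k φ c ((x - waveSpeed k φ * t - ξ₀ : ℝ) : ℂ) ((x - c * t - η₀ : ℝ) : ℂ) := by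
  rw [breatherLogDeriv, breatherFxt]
  push_cast
  rfl

lemma breatherF_ofReal_ne_zero (hφ : 0 < φ) (hb : 0 < breatherBeta k φ c) (ξ η : ℝ) :
    breatherF k φ c ξ η ≠ 0 :=
  breatherF_ne_zero hb (by simp) (by simpa using hφ)

lemma breatherFxt_ne_zero (hb : 0 < breatherBeta k φ c) {z : ℂ} (t : ℝ)
    (h1 : c * z.im ≤ 1) (h2 : k * z.im < φ) : breatherFxt k φ c ξ₀ η₀ z t ≠ 0 :=
  breatherF_ne_zero hb (by simpa using h1) (by simpa using h2)

lemma breather_eq (hφ : 0 < φ) (hb : 0 < breatherBeta k φ c) (x t : ℝ) :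
    breather k φ c ξ₀ η₀ x t = -k + 2 * (breatherLogDeriv k φ c ξ₀ η₀ x t).im := by
  rw [breather, breatherNum_div_breatherDen (breatherF_ofReal_ne_zero hφ hb _ _),
    breatherLogDeriv_ofReal]

lemma norm_breatherLogDeriv_le (hk : 0 < k) (hφ : 0 < φ) (hc : 0 < c)
    (hb : 0 < breatherBeta k φ c) {z : ℂ} (t : ℝ) (h1 : c * z.im ≤ 1) (h2 : k * z.im ≤ φ / 2) :
    ‖breatherLogDeriv k φ c ξ₀ η₀ z t‖ ≤
      (2 * c / breatherBeta k φ c + k) / (1 - Real.exp (-(φ / 2))) :=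
  norm_breatherFx_div_le hk hφ hc hb (by simpa using h1) (by simpa using h2)

lemma hasDerivAt_breatherLogDeriv {z : ℂ} {t : ℝ} (hz : breatherFxt k φ c ξ₀ η₀ z t ≠ 0) :
    HasDerivAt (fun z => breatherLogDeriv k φ c ξ₀ η₀ z t)
      ((breatherFxx k φ c (z - waveSpeed k φ * t - ξ₀) (z - c * t - η₀) *
        breatherF k φ c (z - waveSpeed k φ * t - ξ₀) (z - c * t - η₀) -
        breatherFx k φ c (z - waveSpeed k φ * t - ξ₀) (z - c * t - η₀) *
        breatherFx k φ c (z - waveSpeed k φ * t - ξ₀) (z - c * t - η₀)) /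
        breatherF k φ c (z - waveSpeed k φ * t - ξ₀) (z - c * t - η₀) ^ 2) z := by
  have hξ : HasDerivAt (fun z : ℂ => z - waveSpeed k φ * t - ξ₀) 1 z :=
    ((hasDerivAt_id' z).sub_const _).sub_const _
  have hη : HasDerivAt (fun z : ℂ => z - c * t - η₀) 1 z :=
    ((hasDerivAt_id' z).sub_const _).sub_const _
  exact (hasDerivAt_breatherFx_space hξ hη).div (hasDerivAt_breatherF_space hξ hη) hz

lemma hasDerivAt_im_of_real_curve {g : ℝ → ℂ} {g' : ℂ} {s : ℝ} (h : HasDerivAt g g' s) :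
    HasDerivAt (fun s => (g s).im) g'.im s :=
  Complex.imCLM.hasFDerivAt.comp_hasDerivAt s h

lemma hasDerivAt_re_of_real_curve {g : ℝ → ℂ} {g' : ℂ} {s : ℝ} (h : HasDerivAt g g' s) :
    HasDerivAt (fun s => (g s).re) g'.re s :=
  Complex.reCLM.hasFDerivAt.comp_hasDerivAt s h

lemma contDiff_breather (hden : ∀ ξ η : ℝ, 0 < breatherDen k φ c ξ η) :
    ContDiff ℝ 2 (fun p : ℝ × ℝ => breather k φ c ξ₀ η₀ p.1 p.2) := by
  refine ContDiff.div ?_ ?_ (fun p => (hden _ _).ne')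
  · unfold breatherNum
    fun_prop
  · unfold breatherDen
    fun_prop

theorem isClassicalBOSolution_breather (hk : 0 < k) (hφ : 0 < φ) (hc : 0 < c)
    (hregion : waveSpeed k φ + k < c ∨ c < waveSpeed k φ - k)
    (hden : ∀ ξ η : ℝ, 0 < breatherDen k φ c ξ η) :
    IsClassicalBOSolution (breather k φ c ξ₀ η₀) := by
  have hb := breatherBeta_pos hk hc hregion
  refine ⟨contDiff_breather ξ₀ η₀ hden, fun x t => ?_⟩
  -- The two entries ensure c Im z ≤ 1 and k Im z ≤ φ/2, the conditions for f ≠ 0 and for the bound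
  -- on G.
  set δ := min (1 / c) (φ / (2 * k)) with hδdef
  have hδ : 0 < δ := lt_min (by positivity) (by positivity)
  have hz1 : ∀ z : ℂ, z.im < δ → c * z.im ≤ 1 := fun z hz => by
    have := (hz.trans_le (min_le_left _ _)).le
    rwa [le_div_iff₀ hc, mul_comm] at this
  have hz2 : ∀ z : ℂ, z.im < δ → k * z.im ≤ φ / 2 := fun z hz => by
    have := (hz.trans_le (min_le_right _ _)).le
    rw [le_div_iff₀ (by positivity)] at this
    linarith
  set G : ℂ → ℂ := fun z => breatherLogDeriv k φ c ξ₀ η₀ z t with hG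
  have hf : ∀ z : ℂ, z.im < δ → breatherFxt k φ c ξ₀ η₀ z t ≠ 0 := fun z hz =>
    breatherFxt_ne_zero ξ₀ η₀ hb t (hz1 z hz) (by linarith [hz2 z hz])
  have hd : DifferentiableOn ℂ G {z | z.im < δ} := fun z hz =>
    (hasDerivAt_breatherLogDeriv ξ₀ η₀ (hf z hz)).differentiableAt.differentiableWithinAt
  have hopen : IsOpen {z : ℂ | z.im < δ} := isOpen_lt Complex.continuous_im continuous_const
  have hreal : ∀ s : ℝ, (s : ℂ) ∈ {z : ℂ | z.im < δ} := fun s => by simpa using hδ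
  have hG1 : ∀ s : ℝ, HasDerivAt G (deriv G s) s := fun s =>
    (hd.differentiableAt (hopen.mem_nhds (hreal s))).hasDerivAt
  have hG2 : HasDerivAt (deriv G) (iteratedDeriv 2 G x) x := by
    rw [iteratedDeriv_succ, iteratedDeriv_one]
    exact ((hd.deriv hopen).differentiableAt (hopen.mem_nhds (hreal x))).hasDerivAt
  refine ⟨-(2 * (iteratedDeriv 2 G x).re), ?_, ?_⟩
  · have hH := hasHilbertTransformAt_iteratedDeriv_two_im hδ hd (fun z hz =>
      norm_breatherLogDeriv_le ξ₀ η₀ hk hφ hc hb t (hz1 z hz) (hz2 z hz)) (-k) x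
    have hu : (fun s => breather k φ c ξ₀ η₀ s t) = fun s : ℝ => -k + 2 * (G s).im :=
      funext fun s => breather_eq ξ₀ η₀ hφ hb s t
    rw [hu]
    exact hH
  have hfx : breatherF k φ c ((x : ℂ) - waveSpeed k φ * t - ξ₀) ((x : ℂ) - c * t - η₀) ≠ 0 :=
    hf x (hreal x)
  have hξs : HasDerivAt (fun s : ℝ => (s : ℂ) - waveSpeed k φ * t - ξ₀) 1 x :=
    ((hasDerivAt_id' x).ofReal_comp.sub_const _).sub_const _
  have hηs : HasDerivAt (fun s : ℝ => (s : ℂ) - c * t - η₀) 1 x :=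
    ((hasDerivAt_id' x).ofReal_comp.sub_const _).sub_const _
  have hξt : HasDerivAt (fun τ : ℝ => (x : ℂ) - waveSpeed k φ * τ - ξ₀) (-(waveSpeed k φ : ℂ)) t := by
    simpa using (((hasDerivAt_id' t).ofReal_comp.const_mul (waveSpeed k φ : ℂ)).const_sub
      (x : ℂ)).sub_const (ξ₀ : ℂ)
  have hηt : HasDerivAt (fun τ : ℝ => (x : ℂ) - c * τ - η₀) (-(c : ℂ)) t := by
    simpa using (((hasDerivAt_id' t).ofReal_comp.const_mul (c : ℂ)).const_sub
      (x : ℂ)).sub_const (η₀ : ℂ)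
  have hT := hasDerivAt_im_of_real_curve ((hasDerivAt_breatherFt_space (k := k) (φ := φ) (c := c)
    hξs hηs).div (hasDerivAt_breatherF_space hξs hηs) hfx)
  have hL := hasDerivAt_im_of_real_curve ((hasDerivAt_breatherFx_time (k := k) (φ := φ) (c := c)
    hξt hηt).div (hasDerivAt_breatherF_time hξt hηt) hfx)
  have hut : HasDerivAt (fun τ => breather k φ c ξ₀ η₀ x τ) _ t :=
    ((hL.const_mul 2).const_add (-k)).congr_of_eventuallyEq
      (Eventually.of_forall fun τ => breather_eq ξ₀ η₀ hφ hb x τ)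
  have hux : HasDerivAt (fun s => breather k φ c ξ₀ η₀ s t) (2 * (deriv G x).im) x :=
    (((hasDerivAt_im_comp_ofReal (hG1 x)).const_mul 2).const_add (-k)).congr_of_eventuallyEq
      (Eventually.of_forall fun s => breather_eq ξ₀ η₀ hφ hb s t)
  -- The x-derivative of the integrated equation; it is 0 since the function vanishes for every real
  -- s.
  have hN := (((hT.const_mul 2).const_add (k * waveSpeed k φ)).add (hux.pow 2)).sub
    ((hasDerivAt_re_of_real_curve hG2.comp_ofReal).const_mul 2)
  have hN0 := hN.unique ((hasDerivAt_const x (0 : ℝ)).congr_of_eventuallyEq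
    (Eventually.of_forall fun s => by
      have h1 := breather_riccati hk hφ hregion (breatherF_ofReal_ne_zero hφ hb
        (s - waveSpeed k φ * t - ξ₀) (s - c * t - η₀))
      have h2 : deriv G s = _ := (hasDerivAt_breatherLogDeriv ξ₀ η₀ (hf s (hreal s))).deriv
      have h3 := breather_eq ξ₀ η₀ hφ hb s t
      rw [breatherLogDeriv_ofReal] at h3
      rw [← h3] at h1
      push_cast at h1
      simp only [Pi.add_apply, Pi.sub_apply, Pi.pow_apply, Pi.div_apply, h2]
      exact h1))
  rw [hut.deriv, hux.deriv]
  -- Identifies ∂ₓ(f_t/f) with ∂ₜ(f_x/f), whose quotient-rule numerators differ only in the order of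
  -- one product.
  rw [mul_comm (breatherFt k φ c _ _)] at hN0
  simp only [Nat.cast_ofNat, Nat.add_one_sub_one, pow_one] at hN0
  linear_combination hN0

lemma breather_bounded (hk : 0 < k) (hφ : 0 < φ) (hc : 0 < c) (hb : 0 < breatherBeta k φ c) :
    ∃ M : ℝ, ∀ x t : ℝ, |breather k φ c ξ₀ η₀ x t| ≤ M := by
  refine ⟨k + 2 * ((2 * c / breatherBeta k φ c + k) / (1 - Real.exp (-(φ / 2)))), fun x t => ?_⟩
  rw [breather_eq ξ₀ η₀ hφ hb]
  refine (abs_add_le _ _).trans ?_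
  rw [abs_neg, abs_of_pos hk, abs_mul, abs_two]
  gcongr
  exact (Complex.abs_im_le_norm _).trans
    (norm_breatherLogDeriv_le ξ₀ η₀ hk hφ hc hb t (by simp) (by simp; positivity))

lemma breather_eq_logDeriv (hφ : 0 < φ) (hb : 0 < breatherBeta k φ c) (x t : ℝ) :
    (breather k φ c ξ₀ η₀ x t : ℂ) = Complex.I * logDeriv
      (fun s : ℝ => breatherFxt' k φ c ξ₀ η₀ s t / breatherFxt k φ c ξ₀ η₀ s t) x := by
  have hξ : HasDerivAt (fun s : ℝ => (s : ℂ) - waveSpeed k φ * t - ξ₀) 1 x :=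
    ((hasDerivAt_id' x).ofReal_comp.sub_const _).sub_const _
  have hη : HasDerivAt (fun s : ℝ => (s : ℂ) - c * t - η₀) 1 x :=
    ((hasDerivAt_id' x).ofReal_comp.sub_const _).sub_const _
  have hf : ∀ s : ℝ, breatherFxt k φ c ξ₀ η₀ s t ≠ 0 := fun s => by
    rw [breatherFxt_ofReal]
    exact breatherF_ofReal_ne_zero hφ hb _ _
  -- The exponent is written with the cast of -φ so that `hasDerivAt_breather_exp` applies with -φ
  -- in place of φ.
  have hfun : (fun s : ℝ => breatherFxt' k φ c ξ₀ η₀ s t / breatherFxt k φ c ξ₀ η₀ s t) =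
      fun s : ℝ => -Complex.exp (Complex.I * k * ((s : ℂ) - waveSpeed k φ * t - ξ₀) +
        ((-φ : ℝ) : ℂ)) * (starRingEnd ℂ) (breatherFxt k φ c ξ₀ η₀ s t) /
          breatherFxt k φ c ξ₀ η₀ s t := by
    funext s
    rw [breatherFxt', breatherF'_eq_conj, breatherFxt]
    simp only [map_sub, map_mul, Complex.conj_ofReal, Complex.ofReal_neg, ← sub_eq_add_neg]
  have hF : HasDerivAt (fun s : ℝ => breatherFxt k φ c ξ₀ η₀ s t)
      (breatherFx k φ c ((x : ℂ) - waveSpeed k φ * t - ξ₀) ((x : ℂ) - c * t - η₀)) x :=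
    hasDerivAt_breatherF_space hξ hη
  have hconj : HasDerivAt (fun s : ℝ => (starRingEnd ℂ) (breatherFxt k φ c ξ₀ η₀ s t))
      ((starRingEnd ℂ) (breatherFx k φ c ((x : ℂ) - waveSpeed k φ * t - ξ₀)
        ((x : ℂ) - c * t - η₀))) x :=
    Complex.conjCLE.toContinuousLinearMap.hasFDerivAt.comp_hasDerivAt x hF
  have hQ : HasDerivAt (fun s : ℝ => -Complex.exp (Complex.I * k *
      ((s : ℂ) - waveSpeed k φ * t - ξ₀) + ((-φ : ℝ) : ℂ)) *
        (starRingEnd ℂ) (breatherFxt k φ c ξ₀ η₀ s t) / breatherFxt k φ c ξ₀ η₀ s t) _ x :=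
    (((hasDerivAt_breather_exp (k := k) (φ := -φ) hξ).neg).mul hconj).div hF (hf x)
  have hfx := hf x
  have hFx : (starRingEnd ℂ) (breatherFxt k φ c ξ₀ η₀ x t) ≠ 0 := (map_ne_zero _).2 hfx
  have hexp := Complex.exp_ne_zero (Complex.I * k * ((x : ℂ) - waveSpeed k φ * t - ξ₀) +
    ((-φ : ℝ) : ℂ))
  rw [breather_eq ξ₀ η₀ hφ hb, hfun, logDeriv_apply, hQ.deriv]
  push_cast
  rw [ofReal_im_eq_conj, breatherLogDeriv, map_div₀]
  simp only [Pi.neg_apply, Pi.mul_apply]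
  push_cast at hexp
  generalize Complex.exp _ = E at *
  generalize (starRingEnd ℂ) (breatherFxt k φ c ξ₀ η₀ x t) = F at *
  generalize breatherFxt k φ c ξ₀ η₀ x t = f at *
  generalize (starRingEnd ℂ) (breatherFx k φ c _ _) = Fx at *
  generalize breatherFx k φ c _ _ = fx at *
  field_simp
  linear_combination -(k * f * F) * Complex.I_sq

lemma im_pos_of_breatherFxt_eq_zero (hφ : 0 < φ) (hk : 0 < k) (hc : 0 < c)
    (hb : 0 < breatherBeta k φ c) {z : ℂ} {t : ℝ} (hz : breatherFxt k φ c ξ₀ η₀ z t = 0) :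
    0 < z.im := by
  by_contra hneg
  rw [not_lt] at hneg
  have h1 : c * z.im ≤ 0 := mul_nonpos_of_nonneg_of_nonpos hc.le hneg
  have h2 : k * z.im ≤ 0 := mul_nonpos_of_nonneg_of_nonpos hk.le hneg
  exact breatherFxt_ne_zero ξ₀ η₀ hb t (by linarith) (by linarith) hz

lemma im_neg_of_breatherFxt'_eq_zero (hφ : 0 < φ) (hk : 0 < k) (hc : 0 < c)
    (hb : 0 < breatherBeta k φ c) {z : ℂ} {t : ℝ} (hz : breatherFxt' k φ c ξ₀ η₀ z t = 0) :
    z.im < 0 := by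
  rw [breatherFxt', breatherF'_eq_conj, mul_eq_zero, neg_eq_zero, map_eq_zero] at hz
  have h := hz.resolve_left (Complex.exp_ne_zero _)
  simp only [map_sub, map_mul, Complex.conj_ofReal] at h
  have := im_pos_of_breatherFxt_eq_zero ξ₀ η₀ hφ hk hc hb (z := (starRingEnd ℂ) z) (t := t) h
  simpa using this

end Solution

/-! ### Denominator, exact height of the zeros, and asymptotics. -/

/-- The denominator is |f|²/(2e^φ), and at real arguments |f| ≥ |β+1+icη|(e^φ - 1). The growth in η²
is what the asymptotics need. -/
lemma breatherDen_ge {k φ c : ℝ} (hφ : 0 < φ) (hb : 0 < breatherBeta k φ c) (ξ η : ℝ) :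
    ((breatherBeta k φ c + 1) ^ 2 + c ^ 2 * η ^ 2) * ((Real.exp φ - 1) ^ 2 / (2 * Real.exp φ)) ≤
      breatherDen k φ c ξ η := by
  have h1 := breatherDen_mul k φ c ξ η
  rw [Complex.mul_conj] at h1
  have h2 : breatherDen k φ c ξ η * (2 * Real.exp φ) =
      Complex.normSq (breatherF k φ c ξ η) := by exact_mod_cast h1
  have h3 := le_norm_breatherF (k := k) (φ := φ) (c := c) (ξ := ξ) (η := η) hb (by simp)
  have he : 0 < Real.exp φ - 1 := by
    rw [sub_pos, Real.one_lt_exp_iff]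
    exact hφ
  simp only [Complex.ofReal_im, mul_zero, sub_zero] at h3
  have h4 := pow_le_pow_left₀ (by positivity) h3 2
  rw [mul_pow, ← Complex.normSq_eq_norm_sq, ← Complex.normSq_eq_norm_sq, ← h2,
    normSq_add_one_add] at h4
  simp only [Complex.ofReal_im, mul_zero, sub_zero, Complex.ofReal_re, mul_pow] at h4
  rwa [← mul_div_assoc, div_le_iff₀ (by positivity)]

lemma breatherDen_pos {k φ c : ℝ} (hφ : 0 < φ) (hb : 0 < breatherBeta k φ c) (ξ η : ℝ) :
    0 < breatherDen k φ c ξ η := by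
  have he : 0 < Real.exp φ - 1 := by
    rw [sub_pos, Real.one_lt_exp_iff]
    exact hφ
  exact lt_of_lt_of_le (by positivity) (breatherDen_ge hφ hb ξ η)

/-- At a zero, |β-1-icη| = |β+1+icη| e^{φ - k Im ξ}, so e^{φ - k Im ξ} = e^{-q}; positivity of q is
the strict inequality of the two moduli, which holds as β > 0. -/
lemma im_eq_of_breatherF_eq_zero {k φ c : ℝ} (hk : 0 < k) (hb : 0 < breatherBeta k φ c)
    {ξ : ℂ} {η : ℝ} (h : breatherF k φ c ξ η = 0) :
    0 < breatherQ k φ c η ∧ ξ.im = k⁻¹ * (φ + breatherQ k φ c η) := by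
  rw [breatherF_eq, sub_eq_zero] at h
  have h1 := congrArg Complex.normSq h
  rw [Complex.normSq_mul, normSq_sub_one_sub, normSq_add_one_add,
    Complex.normSq_eq_norm_sq (Complex.exp _), norm_breather_exp] at h1
  simp only [Complex.ofReal_im, mul_zero, add_zero, sub_zero, Complex.ofReal_re, mul_pow] at h1
  rw [breatherQ]
  set P := (breatherBeta k φ c + 1) ^ 2 + c ^ 2 * η ^ 2 with hP
  have hP0 : 0 < P := by positivity
  set w := Real.exp (φ - k * ξ.im) with hw
  have hw0 : 0 < w := Real.exp_pos _
  rw [h1, div_mul_cancel_left₀ hP0.ne', Real.log_inv, Real.log_pow, hw, Real.log_exp]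
  have hlt : P * w ^ 2 < P * 1 := by
    rw [← h1, hP]
    nlinarith
  have hw1 : w < 1 := by
    have := lt_of_mul_lt_mul_left hlt hP0.le
    nlinarith
  rw [hw, Real.exp_lt_one_iff] at hw1
  constructor
  · push_cast
    linarith
  · push_cast
    field_simp
    ring

/-- The breather approaches the periodic wave at the rate `O(1/|η|)`. -/
lemma breather_sub_periodic_le {k φ c : ℝ} (hk : 0 < k) (hφ : 0 < φ) (hc : 0 < c)
    (hb : 0 < breatherBeta k φ c) : ∃ C : ℝ, 0 < C ∧ ∀ ξ η : ℝ, 1 ≤ |η| →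
      |breatherNum k φ c ξ η / breatherDen k φ c ξ η -
        k * Real.sinh φ / (Real.cos (k * ξ) + Real.cosh φ)| ≤ C / |η| := by
  set b := breatherBeta k φ c with hbdef
  set S := Real.sinh φ
  set D := Real.cosh φ
  have hS : 0 < S := Real.sinh_pos_iff.2 hφ
  have hD : 1 < D := Real.one_lt_cosh.2 hφ.ne'
  have he : 0 < Real.exp φ - 1 := by
    rw [sub_pos, Real.one_lt_exp_iff]
    exact hφ
  set κ := (Real.exp φ - 1) ^ 2 / (2 * Real.exp φ)
  have hκ : 0 < κ := by positivity
  -- A is the numerator without its η² and cosine terms. K collects the bounds of all terms left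
  -- after the cancellation below, with |η| ≥ 1 absorbing constants into multiples of |η|.
  set A := 2 * (c + k * b) * D + (k * (1 + b ^ 2) + 2 * b * c) * S
  set K := (A + 2 * c) * (1 + D) +
    k * S * ((1 + b ^ 2) * D + 2 * b * S + (1 + b ^ 2) + 2 * b * c)
  have hA : 0 < A := by positivity
  have hK : 0 < K := by positivity
  refine ⟨K / (c ^ 2 * κ * (D - 1)), div_pos hK (mul_pos (by positivity) (by linarith)), ?_⟩
  intro ξ η hη
  have hη0 : 0 < |η| := by linarith
  have hden := breatherDen_pos (c := c) hφ hb ξ η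
  have hge := breatherDen_ge (c := c) hφ hb ξ η
  have hC1 := Real.abs_cos_le_one (k * ξ)
  have hS1 := Real.abs_sin_le_one (k * ξ)
  have hCD : D - 1 ≤ Real.cos (k * ξ) + D := by linarith [(abs_le.1 hC1).1]
  have hCD0 : 0 < Real.cos (k * ξ) + D := by linarith
  have hnum : |breatherNum k φ c ξ η * (Real.cos (k * ξ) + D) -
      breatherDen k φ c ξ η * (k * S)| ≤ K * |η| := by
    -- The contributions k c² η² sinh φ (cos kξ + cosh φ) of the two products cancel, leaving growth
    -- at most linear in η.
    have heq : breatherNum k φ c ξ η * (Real.cos (k * ξ) + D) -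
        breatherDen k φ c ξ η * (k * S) =
        (A + 2 * c * Real.cos (k * ξ)) * (Real.cos (k * ξ) + D) -
          k * S * ((1 + b ^ 2) * D + 2 * b * S + (1 - b ^ 2) * Real.cos (k * ξ) +
            2 * b * c * (η * Real.sin (k * ξ))) := by
      rw [breatherNum, breatherDen]
      ring
    have t1 : |A + 2 * c * Real.cos (k * ξ)| ≤ A + 2 * c := by
      refine (abs_add_le _ _).trans ?_
      rw [abs_of_pos hA, abs_mul, abs_of_pos (by positivity : 0 < 2 * c)]
      nlinarith
    have t2 : |Real.cos (k * ξ) + D| ≤ 1 + D := by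
      rw [abs_of_pos hCD0]
      linarith [(abs_le.1 hC1).2]
    have t3 : |(1 - b ^ 2) * Real.cos (k * ξ)| ≤ 1 + b ^ 2 := by
      rw [abs_mul]
      have : |1 - b ^ 2| ≤ 1 + b ^ 2 := by
        rw [abs_le]
        constructor <;> nlinarith
      calc |1 - b ^ 2| * |Real.cos (k * ξ)| ≤ (1 + b ^ 2) * 1 := by gcongr
        _ = _ := mul_one _
    have t4 : |2 * b * c * (η * Real.sin (k * ξ))| ≤ 2 * b * c * |η| := by
      rw [abs_mul, abs_of_pos (by positivity : 0 < 2 * b * c), abs_mul]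
      gcongr
      exact mul_le_of_le_one_right hη0.le hS1
    have t5 : |(1 + b ^ 2) * D + 2 * b * S + (1 - b ^ 2) * Real.cos (k * ξ) +
        2 * b * c * (η * Real.sin (k * ξ))| ≤
        (1 + b ^ 2) * D + 2 * b * S + (1 + b ^ 2) + 2 * b * c * |η| := by
      refine (abs_add_le _ _).trans (add_le_add ((abs_add_le _ _).trans (add_le_add ?_ t3)) t4)
      rw [abs_of_pos (by positivity)]
    rw [heq]
    calc |(A + 2 * c * Real.cos (k * ξ)) * (Real.cos (k * ξ) + D) -
          k * S * ((1 + b ^ 2) * D + 2 * b * S + (1 - b ^ 2) * Real.cos (k * ξ) +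
            2 * b * c * (η * Real.sin (k * ξ)))|
        ≤ (A + 2 * c) * (1 + D) +
          k * S * ((1 + b ^ 2) * D + 2 * b * S + (1 + b ^ 2) + 2 * b * c * |η|) := by
          refine (abs_sub _ _).trans (add_le_add ?_ ?_)
          · rw [abs_mul]
            gcongr
          · rw [abs_mul, abs_of_pos (by positivity : 0 < k * S)]
            gcongr
      _ ≤ (A + 2 * c) * (1 + D) * |η| + k * S * (((1 + b ^ 2) * D + 2 * b * S + (1 + b ^ 2)) *
            |η| + 2 * b * c * |η|) := by
          refine add_le_add (le_mul_of_one_le_right (by positivity) hη) ?_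
          gcongr
          exact le_mul_of_one_le_right (by positivity) hη
      _ = K * |η| := by ring
  rw [div_sub_div _ _ hden.ne' hCD0.ne', abs_div, abs_of_pos (mul_pos hden hCD0)]
  have hD2 : c ^ 2 * |η| ^ 2 * κ ≤ breatherDen k φ c ξ η := by
    refine le_trans ?_ hge
    rw [sq_abs]
    gcongr
    nlinarith [sq_nonneg (b + 1)]
  have hD1 : 0 < D - 1 := by linarith
  calc _ ≤ K * |η| / (c ^ 2 * |η| ^ 2 * κ * (D - 1)) := by gcongr
    _ = _ := by
      field_simp

theorem mainTheorem2 (k φ c ξ₀ η₀ : ℝ) (hk : 0 < k) (hφ : 0 < φ) (hc : 0 < c)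
    (hregion : waveSpeed k φ + k < c ∨ c < waveSpeed k φ - k) :
    -- the breather is well defined and solves the equation
    (∀ ξ η : ℝ, 0 < breatherDen k φ c ξ η) ∧
    IsClassicalBOSolution (breather k φ c ξ₀ η₀) ∧
    -- it is bounded on the whole plane
    (∃ M : ℝ, ∀ x t : ℝ, |breather k φ c ξ₀ η₀ x t| ≤ M) ∧
    -- it equals `i ∂ₓ log (f' / f)`
    (∀ x t : ℝ, (breather k φ c ξ₀ η₀ x t : ℂ) =
      Complex.I * logDeriv
        (fun s : ℝ => breatherFxt' k φ c ξ₀ η₀ s t / breatherFxt k φ c ξ₀ η₀ s t) x) ∧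
    -- the zeros of `f` (of `f'`) lie in the open upper (lower) half-plane
    (∀ (z : ℂ) (t : ℝ), breatherFxt k φ c ξ₀ η₀ z t = 0 → 0 < z.im) ∧
    (∀ (z : ℂ) (t : ℝ), breatherFxt' k φ c ξ₀ η₀ z t = 0 → z.im < 0) ∧
    -- the imaginary part of a zero `ξ` of `f`, for real `η`
    (∀ (ξ : ℂ) (η : ℝ), breatherF k φ c ξ η = 0 →
      0 < breatherQ k φ c η ∧ ξ.im = k⁻¹ * (φ + breatherQ k φ c η)) ∧
    -- convergence to the same periodic wave (same `ξ₀`) as `η → ±∞`, uniformly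
    (∀ ε : ℝ, 0 < ε → ∃ R : ℝ, ∀ x t : ℝ, R ≤ |x - c * t - η₀| →
      |breather k φ c ξ₀ η₀ x t - periodicWave k φ ξ₀ x t| < ε) := by
  have hb := breatherBeta_pos hk hc hregion
  have hden := breatherDen_pos (c := c) hφ hb
  refine ⟨hden, isClassicalBOSolution_breather ξ₀ η₀ hk hφ hc hregion hden,
    breather_bounded ξ₀ η₀ hk hφ hc hb, breather_eq_logDeriv ξ₀ η₀ hφ hb,
    fun z t hz => im_pos_of_breatherFxt_eq_zero ξ₀ η₀ hφ hk hc hb hz,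
    fun z t hz => im_neg_of_breatherFxt'_eq_zero ξ₀ η₀ hφ hk hc hb hz,
    fun ξ η h => im_eq_of_breatherF_eq_zero hk hb h, fun ε hε => ?_⟩
  obtain ⟨C, hC, hle⟩ := breather_sub_periodic_le hk hφ hc hb
  -- The 1 secures |η| ≥ 1 for the rate estimate and makes |η| > C/ε strict.
  refine ⟨1 + C / ε, fun x t hR => ?_⟩
  have hCε : 0 < C / ε := div_pos hC hε
  refine (hle _ _ (by linarith)).trans_lt ?_
  rw [div_lt_iff₀ (by linarith), ← div_lt_iff₀' hε]
  linarith
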